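/- Let $N\in\mathbb N$ and let $\Phi\in L^\infty(\mathbb R)\otimes M_N(\mathbb C)$ be a projection, i.e. $\Phi(p)^*=\Phi(p)=\Phi(p)^2$ for almost every $p\in\mathbb R$. The Fourier transform is normalized as $\hat f(p)=\int_{\mathbb R}f(x)e^{-ipx}\,dx$ and extended to tempered distributions by duality, and $|A|^2=A^*A$ for a matrix $A$. Let $K=L^2((0,\infty),\mathbb C^N)$, regarded as a closed subspace of $\tilde K=L^2(\mathbb R,\mathbb C^N)$, let $P_+$ be the orthogonal projection of $\tilde K$ onto $K$, let $C_\Phi$ be the Fourier multiplier on $\tilde K$ given by $\widehat{C_\Phi f}(p)=\Phi(p)\hat f(p)$, and let $H_\Phi:K\to K^\perp$, $H_\Phi f=(1-P_+)C_\Phi f$, be the Hankel operator with symbol $\Phi$. The projection $\Phi$ is called \emph{admissible} if $H_\Phi$ is a Hilbert--Schmidt operator. Then the following three conditions are equivalent: (1) $\Phi$ is admissible. (2) $\displaystyle\int_{\mathbb R^2}\frac{\operatorname{tr}(|\Phi(p)-\Phi(q)|^2)}{|p-q|^2}\,dp\,dq<\infty.$ (3) There exists an $M_N(\mathbb C)$-valued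 measurable function $\hat\Phi_0$ on $\mathbb R$ such that $\displaystyle\int_{\mathbb R}|x|\operatorname{tr}(|\hat\Phi_0(x)|^2)\,dx<\infty$ and $x\hat\Phi(x)=x\hat\Phi_0(x)$ as $M_N(\mathbb C)$-valued tempered distributions. Moreover: (i) If $\Phi$ is admissible, then $\displaystyle\int_{\mathbb R}\operatorname{tr}(|\Phi(2p)-\Phi(p)|^2)\,\frac{dp}{|p|}<\infty.$ (ii) If $\Phi$ (i.e. some representative of its almost-everywhere class) is an even differentiable function satisfying $\displaystyle\int_0^\infty\operatorname{tr}(|\Phi'(p)|^2)\,p\,dp<\infty$, then $\Phi$ is admissible. -/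

import Mathlib

open MeasureTheory SchwartzMap
open scoped ENNReal FourierTransform Matrix.Norms.L2Operator

noncomputable section

namespace CARFlow

/-- The Hilbert space `L²(ℝ, ℂᴺ)`. -/
abbrev L2Line (N : ℕ) : Type :=
  Lp (EuclideanSpace ℂ (Fin N)) 2 (volume : Measure ℝ)

/-- The subspace `K = L²((0,∞), ℂᴺ)` of `L²(ℝ, ℂᴺ)`: the functions whose restriction to `(-∞, 0]`
vanishes almost everywhere. -/
def halfLine (N : ℕ) : Submodule ℂ (L2Line N) :=
  LinearMap.ker
    (LpToLpRestrictCLM ℝ (EuclideanSpace ℂ (Fin N)) ℂ volume 2 (Set.Iic 0)).toLinearMap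

theorem isClosed_halfLine (N : ℕ) : IsClosed (halfLine N : Set (L2Line N)) :=
  ContinuousLinearMap.isClosed_ker
    (LpToLpRestrictCLM ℝ (EuclideanSpace ℂ (Fin N)) ℂ volume 2 (Set.Iic 0))

instance instCompleteSpaceHalfLine (N : ℕ) : CompleteSpace (halfLine N) :=
  (isClosed_halfLine N).completeSpace_coe

/-- Membership in `halfLine` is vanishing almost everywhere on `(-∞, 0]`. -/
theorem mem_halfLine_iff (N : ℕ) (f : L2Line N) :
    f ∈ halfLine N ↔ ∀ᵐ x ∂(volume.restrict (Set.Iic (0 : ℝ))), f x = 0 := by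
  have h := LpToLpRestrictCLM_coeFn (μ := volume) (p := 2) ℂ (Set.Iic (0 : ℝ)) f
  have e : f ∈ halfLine N ↔
      LpToLpRestrictCLM ℝ (EuclideanSpace ℂ (Fin N)) ℂ volume 2 (Set.Iic 0) f = 0 := Iff.rfl
  rw [e, Lp.eq_zero_iff_ae_eq_zero]
  constructor
  · intro h0
    filter_upwards [h, h0] with x hx hx0
    rw [← hx, hx0]
    rfl
  · intro h0
    filter_upwards [h, h0] with x hx hx0
    rw [hx, hx0]
    rfl

/-- `L^∞(ℝ) ⊗ M_N(ℂ)`: essentially bounded matrix-valued functions, modulo null sets. -/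
abbrev MatrixSymbol (N : ℕ) : Type :=
  Lp (Matrix (Fin N) (Fin N) ℂ) ∞ (volume : Measure ℝ)

/-- `Φ` is a projection of the von Neumann algebra `L^∞(ℝ) ⊗ M_N(ℂ)`. -/
def IsProjectionSymbol {N : ℕ} (Φ : MatrixSymbol N) : Prop :=
  ∀ᵐ p : ℝ, IsStarProjection (Φ p)

theorem memLp_rescale {N : ℕ} (Φ : MatrixSymbol N) :
    MemLp (fun ξ : ℝ => Φ (2 * Real.pi * ξ)) ∞ volume := by
  have h0 : (2 * Real.pi : ℝ) ≠ 0 := by positivity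
  have hΦ : MemLp Φ ∞ (Measure.map (fun ξ : ℝ => 2 * Real.pi * ξ) volume) := by
    rw [Real.map_volume_mul_left h0]
    exact (Lp.memLp Φ).smul_measure ENNReal.ofReal_ne_top
  exact hΦ.comp_of_map (by fun_prop)

/-- The rescaled symbol `ξ ↦ Φ(2πξ)`. -/
def rescale {N : ℕ} (Φ : MatrixSymbol N) : MatrixSymbol N :=
  (memLp_rescale Φ).toLp

/-- The action of matrices on `ℂᴺ`, as a continuous bilinear map. -/
def matrixAction (N : ℕ) :
    Matrix (Fin N) (Fin N) ℂ →L[ℂ]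
      EuclideanSpace ℂ (Fin N) →L[ℂ] EuclideanSpace ℂ (Fin N) :=
  LinearMap.toContinuousLinearMap
    (Matrix.toEuclideanCLM (n := Fin N) (𝕜 := ℂ)).toAlgEquiv.toLinearMap

@[simp]
theorem matrixAction_apply (N : ℕ) (A : Matrix (Fin N) (Fin N) ℂ) (v : EuclideanSpace ℂ (Fin N)) :
    matrixAction N A v = WithLp.toLp 2 (Matrix.mulVec A v.ofLp) := rfl

/-- Pointwise multiplication by the symbol `Φ` on `L²(ℝ, ℂᴺ)`. -/
def multiplication {N : ℕ} (Φ : MatrixSymbol N) : L2Line N →L[ℂ] L2Line N :=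
  (matrixAction N).holderL volume ∞ 2 2 Φ

/-- The Fourier multiplier `C_Φ`, determined by `(C_Φ f)^(p) = Φ(p) f^(p)`, where
`f^(p) = ∫ f(x) exp(-ipx) dx`. Mathlib's Fourier transform is `𝓕 f (ξ) = f^(2πξ)`, so that
`𝓕 (C_Φ f) (ξ) = Φ(2πξ) 𝓕 f (ξ)`. -/
def fourierMultiplier {N : ℕ} (Φ : MatrixSymbol N) : L2Line N →L[ℂ] L2Line N :=
  let F := Lp.fourierTransformₗᵢ ℝ (EuclideanSpace ℂ (Fin N))
  (F.symm.toContinuousLinearEquiv : L2Line N →L[ℂ] L2Line N) ∘L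
    multiplication (rescale Φ) ∘L (F.toContinuousLinearEquiv : L2Line N →L[ℂ] L2Line N)

theorem fourier_fourierMultiplier {N : ℕ} (Φ : MatrixSymbol N) (f : L2Line N) :
    ∀ᵐ ξ : ℝ, (𝓕 (fourierMultiplier Φ f)) ξ
      = WithLp.toLp 2 (Matrix.mulVec (Φ (2 * Real.pi * ξ)) ((𝓕 f) ξ).ofLp) := by
  have h : 𝓕 (fourierMultiplier Φ f) = multiplication (rescale Φ) (𝓕 f) :=
    (Lp.fourierTransformₗᵢ ℝ (EuclideanSpace ℂ (Fin N))).apply_symm_apply _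
  rw [h]
  have h1 := (matrixAction N).coeFn_holder (r := 2) (rescale Φ) (𝓕 f)
  have h2 : rescale Φ =ᵐ[volume] fun ξ : ℝ => Φ (2 * Real.pi * ξ) := (memLp_rescale Φ).coeFn_toLp
  filter_upwards [h1, h2] with ξ a b
  rw [← b]
  exact a

/-- The Hankel operator `H_Φ : K → Kᗮ`, `H_Φ f = (1 - P₊) C_Φ f`, where `P₊` is the orthogonal
projection onto `K = L²((0,∞), ℂᴺ)`. -/
def hankel {N : ℕ} (Φ : MatrixSymbol N) : halfLine N →L[ℂ] (halfLine N)ᗮ :=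
  (halfLine N)ᗮ.orthogonalProjectionOnto ∘L fourierMultiplier Φ ∘L (halfLine N).subtypeL

theorem coe_hankel {N : ℕ} (Φ : MatrixSymbol N) (f : halfLine N) :
    (hankel Φ f : L2Line N) =
      fourierMultiplier Φ f - (halfLine N).starProjection (fourierMultiplier Φ f) := by
  exact Submodule.starProjection_orthogonal_val _

/-- `T` is a Hilbert–Schmidt operator: `tr(T* T) = ∑ ‖T eᵢ‖² < ∞` for an orthonormal basis `(eᵢ)`
(the sum does not depend on the basis). -/
def IsHilbertSchmidt {E F : Type*} [NormedAddCommGroup E] [InnerProductSpace ℂ E]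
    [NormedAddCommGroup F] [InnerProductSpace ℂ F] (T : E →L[ℂ] F) : Prop :=
  ∃ (w : Set E) (b : HilbertBasis w ℂ E), Summable fun i => ‖T (b i)‖ ^ 2

/-- A symbol is admissible if it is a projection whose Hankel operator is Hilbert–Schmidt. -/
def IsAdmissible {N : ℕ} (Φ : MatrixSymbol N) : Prop :=
  IsProjectionSymbol Φ ∧ IsHilbertSchmidt (hankel Φ)

/-- `tr(|A|²) = tr(A* A)`. -/
def trAbsSq {N : ℕ} (A : Matrix (Fin N) (Fin N) ℂ) : ℝ :=
  (A.conjTranspose * A).trace.re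

theorem trAbsSq_eq {N : ℕ} (A : Matrix (Fin N) (Fin N) ℂ) :
    trAbsSq A = ∑ j, ∑ i, ‖A i j‖ ^ 2 := by
  simp only [trAbsSq, Matrix.trace, Matrix.diag, Matrix.mul_apply, Matrix.conjTranspose_apply,
    Complex.re_sum]
  refine Finset.sum_congr rfl fun j _ => Finset.sum_congr rfl fun i _ => ?_
  rw [Complex.star_def, ← Complex.normSq_eq_conj_mul_self, Complex.ofReal_re,
    Complex.normSq_eq_norm_sq]

/-- The Fourier transform `g^(p) = ∫ g(x) exp(-ipx) dx` of Schwartz functions on `ℝ`,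
that is `g^(p) = 𝓕 g (p / 2π)`. -/
def schwartzHat : 𝓢(ℝ, ℂ) →L[ℂ] 𝓢(ℝ, ℂ) :=
  SchwartzMap.compCLMOfContinuousLinearEquiv ℂ
      (ContinuousLinearEquiv.smulLeft (R₁ := ℝ) (M₁ := ℝ)
        (Units.mk0 (2 * Real.pi)⁻¹ (by positivity)))
    ∘L FourierTransform.fourierCLM ℂ 𝓢(ℝ, ℂ)

theorem schwartzHat_apply (g : 𝓢(ℝ, ℂ)) (p : ℝ) :
    schwartzHat g p = ∫ x : ℝ, g x * Complex.exp (-Complex.I * p * x) := by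
  have h : schwartzHat g p = 𝓕 (g : ℝ → ℂ) ((2 * Real.pi)⁻¹ * p) := by
    rw [← SchwartzMap.fourier_coe]
    rfl
  rw [h, Real.fourier_real_eq_integral_exp_smul]
  refine integral_congr_ae (Filter.Eventually.of_forall fun x => ?_)
  have hpi : (Real.pi : ℂ) ≠ 0 := by exact_mod_cast Real.pi_ne_zero
  simp only [smul_eq_mul]
  rw [mul_comm]
  congr 2
  push_cast
  field_simp

/-- The Fourier transform of tempered distributions dual to `schwartzHat`: `⟨T^, g⟩ = ⟨T, g^⟩`. -/
def distHat {F : Type*} [NormedAddCommGroup F] [NormedSpace ℂ F] (T : 𝓢'(ℝ, F)) : 𝓢'(ℝ, F) :=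
  PointwiseConvergenceCLM.precomp F schwartzHat T

theorem distHat_apply {F : Type*} [NormedAddCommGroup F] [NormedSpace ℂ F] (T : 𝓢'(ℝ, F))
    (g : 𝓢(ℝ, ℂ)) : distHat T g = T (schwartzHat g) := rfl

/-- The product `x T` of a distribution on `ℝ` with the coordinate function. -/
def coordMul {F : Type*} [NormedAddCommGroup F] [NormedSpace ℂ F] (T : 𝓢'(ℝ, F)) : 𝓢'(ℝ, F) :=
  TemperedDistribution.smulLeftCLM F (fun x : ℝ => (x : ℂ)) T

theorem hasTemperateGrowth_coord : (fun x : ℝ => (x : ℂ)).HasTemperateGrowth :=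
  Complex.ofRealCLM.hasTemperateGrowth

theorem coordMul_apply {F : Type*} [NormedAddCommGroup F] [NormedSpace ℂ F] (T : 𝓢'(ℝ, F))
    (g h : 𝓢(ℝ, ℂ)) (hh : ∀ x : ℝ, h x = x * g x) : coordMul T g = T h := by
  have : SchwartzMap.smulLeftCLM ℂ (fun x : ℝ => (x : ℂ)) g = h := by
    ext x
    rw [SchwartzMap.smulLeftCLM_apply_apply hasTemperateGrowth_coord, hh, smul_eq_mul]
  rw [coordMul, TemperedDistribution.smulLeftCLM_apply_apply, this]

/-- `Ψ` is a measurable matrix-valued function with `∫ |x| tr(|Ψ(x)|²) dx < ∞` and `x Φ^ = x Ψ` as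
matrix-valued distributions. The first condition makes `x Ψ(x)` locally integrable, and integrable
against Schwartz functions. -/
structure IsRegularPart {N : ℕ} (Φ : MatrixSymbol N) (Ψ : ℝ → Matrix (Fin N) (Fin N) ℂ) :
    Prop where
  measurable : ∀ i j, Measurable fun x => Ψ x i j
  finite : ∫⁻ x : ℝ, ENNReal.ofReal (|x| * trAbsSq (Ψ x)) < ∞
  eq_dist : ∀ g : 𝓢(ℝ, ℂ),
    coordMul (distHat (Lp.toTemperedDistribution Φ)) g = ∫ x : ℝ, g x • (x : ℂ) • Ψ x

end CARFlow

end

/-!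
All conditions are compared with one quantity, the energy
`energy f = ∫∫ |f(p) - f(q)|² / |p - q|² dp dq` of the entries `f` of the symbol; it is invariant
under the rescaling `p = 2πs` that relates the two normalizations of the Fourier transform. Condition
(2) says that all the energies are finite, since `tr(|A|²)` is the sum of the `|A i j|²`.

*Hilbert–Schmidt operators.* The Hankel operator is tested on the vectors
`exp(2πiqx - 2πεx) 1_{x>0} ⊗ e_j`, `q ∈ ℝ`, of `K` (`rightVec`) and on their mirror images in `Kᗮ`
(`leftVec`). By Plancherel's identity they satisfy Bessel's inequality for every `ε > 0`, and the
former become a tight frame of `K` as `ε → 0`; so they compute Hilbert–Schmidt norms like bases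
(`isHilbertSchmidt_of_frames`, `lintegral_enorm_sq_le_of_bessel`). Their Fourier transforms are
Cauchy kernels with poles at distance `ε` from the real axis. If the energies are finite, then
`enorm_hankel_rightVec_le` bounds the images of the vectors: the constant `Φ(q)` can be subtracted
from the symbol, and the Cauchy kernel is dominated by `1 / |s - q|`. Conversely, the matrix elements
of the Hankel operator are integrals of the entries against a product of two Cauchy kernels
(`inner_leftVec_hankel_rightVec`). By partial fractions the products, for both signs of the poles, add
up to a difference of Poisson kernels divided by `p - q` (`poissonMean_sub`), and self-adjointness of
the symbol provides the second sign. Hence the energies of the Poisson means are bounded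
(`energy_poissonMean_le`), and Fatou's lemma applies because the means converge almost everywhere
(`tendsto_poissonMean`).

*The regular part of the Fourier transform.* Formally, the Fourier transform of `f(· + h) - f` is
`(exp(2πihx) - 1) u(x)`, where `u` is the Fourier transform of `f`. Plancherel's identity and an
integration over `h` with the weight `1 / h²` give `energy f = c ∫ |x| |u(x)|² dx`
(`energy_eq_of_regularPart`). In the converse direction `u` is defined from a single difference that
is square integrable (`exists_regularPart`). The identity for `x 𝓕f` and those for the differences are
obtained from each other by differentiating and integrating in `h`
(`integral_fourier_mul_sub_eq`, `integral_fourier_coordMul_eq`).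

*The two consequences.* The integral over the differences `f(2p) - f(p)` is bounded by the energy, by
averaging over intermediate points between `p` and `2p` (`lintegral_dilation_two_le`). For an even
differentiable function it is enough to consider pairs of positive points `sp < p`; there the
Cauchy–Schwarz inequality along the segment, with the weight `t`, bounds the integral over `p` by
`log² s ∫ |f'(p)|² p dp`, and `log² s / (1 - s)²` is integrable on `(0, 1)`
(`energy_lt_top_of_even`).
-/

noncomputable section

namespace CARFlow

/-! ### Fourier transforms of square integrable functions -/

section Fourier
variable {F : Type*} [NormedAddCommGroup F] [InnerProductSpace ℂ F] [CompleteSpace F]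

/-- Locally integrable functions with the same pairings against Schwartz functions agree almost
everywhere. -/
theorem ae_eq_of_schwartz_pairing {u v : ℝ → F} (hu : LocallyIntegrable u) (hv : LocallyIntegrable v)
    (h : ∀ g : 𝓢(ℝ, ℂ), ∫ x, g x • u x = ∫ x, g x • v x) : u =ᵐ[volume] v := by
  refine ae_eq_of_integral_contDiff_smul_eq hu hv fun g hg hc => ?_
  have hg₁ : HasCompactSupport (Complex.ofRealCLM ∘ g) := hc.comp_left rfl
  have hg₂ : ContDiff ℝ (⊤ : ℕ∞) (Complex.ofRealCLM ∘ g) :=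
    Complex.ofRealCLM.contDiff.comp hg
  simpa using h (hg₁.toSchwartzMap hg₂)

omit [CompleteSpace F] in
theorem continuous_fourier_of_integrable {f : ℝ → F} (h1 : Integrable f) : Continuous (𝓕 f) :=
  VectorFourier.fourierIntegral_continuous Real.continuous_fourierChar
    (L := innerₗ ℝ) continuous_inner h1

/-- On `L¹ ∩ L²` the Fourier transform of `L²` is given by the Fourier integral. -/
theorem coeFn_fourier_toLp {f : ℝ → F} (h1 : Integrable f) (h2 : MemLp f 2) :
    (𝓕 (h2.toLp f) : Lp F 2 (volume : Measure ℝ)) =ᵐ[volume] 𝓕 f := by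
  refine ae_eq_of_schwartz_pairing ((Lp.memLp _).locallyIntegrable (by norm_num))
    (continuous_fourier_of_integrable h1).locallyIntegrable fun g => ?_
  have h := DFunLike.congr_fun (Lp.fourier_toTemperedDistribution_eq (h2.toLp f)) g
  rw [TemperedDistribution.fourier_apply, Lp.toTemperedDistribution_apply,
    Lp.toTemperedDistribution_apply] at h
  rw [← h]
  have e := VectorFourier.integral_fourierIntegral_smul_eq_flip (L := innerₗ ℝ)
      Real.continuous_fourierChar continuous_inner (g.integrable (μ := volume)) h1
  rw [flip_innerₗ] at e
  refine Eq.trans (integral_congr_ae ?_) e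
  filter_upwards [h2.coeFn_toLp] with x hx
  rw [hx, SchwartzMap.fourier_coe]
  rfl

omit [InnerProductSpace ℂ F] [CompleteSpace F] in
theorem lintegral_enorm_sq_eq_enorm_sq (f : Lp F 2 (volume : Measure ℝ)) :
    ∫⁻ x, ‖f x‖ₑ ^ 2 = ‖f‖ₑ ^ 2 := by
  rw [Lp.enorm_def, eLpNorm_eq_lintegral_rpow_enorm_toReal (by norm_num) (by norm_num),
    ← ENNReal.rpow_natCast, ← ENNReal.rpow_mul]
  simp

/-- Plancherel's identity for the Fourier integral on `L¹ ∩ L²`. -/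
theorem lintegral_enorm_fourier_sq {f : ℝ → F} (h1 : Integrable f) (h2 : MemLp f 2) :
    ∫⁻ x, ‖𝓕 f x‖ₑ ^ 2 = ∫⁻ x, ‖f x‖ₑ ^ 2 := by
  have a : ∫⁻ x, ‖𝓕 f x‖ₑ ^ 2 = ‖𝓕 (h2.toLp f)‖ₑ ^ 2 := by
    rw [← lintegral_enorm_sq_eq_enorm_sq]
    refine lintegral_congr_ae ?_
    filter_upwards [coeFn_fourier_toLp h1 h2] with x hx
    rw [hx]
  have b : ∫⁻ x, ‖f x‖ₑ ^ 2 = ‖h2.toLp f‖ₑ ^ 2 := by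
    rw [← lintegral_enorm_sq_eq_enorm_sq]
    refine lintegral_congr_ae ?_
    filter_upwards [h2.coeFn_toLp] with x hx
    rw [hx]
  rw [a, b, ← ofReal_norm, Lp.norm_fourier_eq, ofReal_norm]
end Fourier

/-! ### Hilbert–Schmidt operators and frames -/

section HilbertSchmidt
open ContinuousLinearMap
variable {E F : Type*} [NormedAddCommGroup E] [InnerProductSpace ℂ E] [CompleteSpace E]
    [NormedAddCommGroup F] [InnerProductSpace ℂ F] [CompleteSpace F]

omit [CompleteSpace E] in
theorem enorm_inner_symm (x y : E) : ‖inner ℂ x y‖ₑ = ‖inner ℂ y x‖ₑ := by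
  rw [← ofReal_norm, norm_inner_symm, ofReal_norm]

omit [CompleteSpace E] in
/-- Parseval's identity, with values in `[0, ∞]`. -/
theorem tsum_enorm_inner_sq {ι : Type*} (b : HilbertBasis ι ℂ E) (x : E) :
    ∑' i, ‖inner ℂ (b i) x‖ₑ ^ 2 = ‖x‖ₑ ^ 2 := by
  have h := b.hasSum_inner_mul_inner x x
  have h' : HasSum (fun i => ‖inner ℂ (b i) x‖ ^ 2) (‖x‖ ^ 2) := by
    have := Complex.hasSum_re h
    rw [inner_self_eq_norm_sq_to_K] at this
    convert! this using 1
    · ext i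
      rw [← inner_conj_symm x (b i), RCLike.conj_mul]
      norm_cast
    · norm_cast
  have e : ∀ y : ℂ, ‖y‖ₑ ^ 2 = ENNReal.ofReal (‖y‖ ^ 2) := fun y => by
    rw [← ofReal_norm, ENNReal.ofReal_pow (norm_nonneg _)]
  simp_rw [e]
  rw [← ENNReal.ofReal_tsum_of_nonneg (fun _ => by positivity) h'.summable, h'.tsum_eq,
    ← ofReal_norm, ENNReal.ofReal_pow (norm_nonneg _)]

/-- An operator and its adjoint have the same Hilbert–Schmidt norm, computed in any bases. -/
theorem tsum_enorm_adjoint_sq {ι κ : Type*} (b : HilbertBasis ι ℂ E) (c : HilbertBasis κ ℂ F)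
    (T : E →L[ℂ] F) : ∑' i, ‖T (b i)‖ₑ ^ 2 = ∑' k, ‖adjoint T (c k)‖ₑ ^ 2 := by
  simp_rw [← tsum_enorm_inner_sq b, ← tsum_enorm_inner_sq c]
  rw [ENNReal.tsum_comm]
  refine tsum_congr fun k => tsum_congr fun i => ?_
  rw [adjoint_inner_right, enorm_inner_symm]

omit [InnerProductSpace ℂ E] [CompleteSpace E] in
theorem summable_norm_sq_iff {ι : Type*} (u : ι → E) :
    (Summable fun i => ‖u i‖ ^ 2) ↔ ∑' i, ‖u i‖ₑ ^ 2 < ∞ := by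
  have e : ∀ i, ‖u i‖ₑ ^ 2 = ((‖u i‖₊ ^ 2 : NNReal) : ℝ≥0∞) := fun i => by simp [enorm]
  simp_rw [e, lt_top_iff_ne_top, ENNReal.tsum_coe_ne_top_iff_summable, ← NNReal.summable_coe]
  simp

/-- The Hilbert–Schmidt property is tested on the adjoint and an arbitrary orthonormal basis. -/
theorem isHilbertSchmidt_iff {κ : Type*} (c : HilbertBasis κ ℂ F) (T : E →L[ℂ] F) :
    IsHilbertSchmidt T ↔ ∑' k, ‖adjoint T (c k)‖ₑ ^ 2 < ∞ := by
  constructor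
  · rintro ⟨w, b, h⟩
    rw [← tsum_enorm_adjoint_sq b, ← summable_norm_sq_iff]
    exact h
  · intro h
    obtain ⟨w, b, -⟩ := exists_hilbertBasis ℂ E
    exact ⟨w, b, by rwa [summable_norm_sq_iff, tsum_enorm_adjoint_sq b c]⟩

variable {Λ : Type*} [MeasurableSpace Λ] {μ : Measure Λ}

/-- A Bessel family `v` (a family with `∫ |⟨v_λ, x⟩|² dλ ≤ ‖x‖²`) is mapped by `T` to a family of
square norm at most the square of the Hilbert–Schmidt norm. -/
theorem lintegral_enorm_sq_le_of_bessel {κ : Type*} (c : HilbertBasis κ ℂ F) (T : E →L[ℂ] F)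
    (hT : IsHilbertSchmidt T) (v : Λ → E) (hm : ∀ x, AEMeasurable (fun l => inner ℂ (v l) x) μ)
    (hv : ∀ x, ∫⁻ l, ‖inner ℂ (v l) x‖ₑ ^ 2 ∂μ ≤ ‖x‖ₑ ^ 2) :
    ∫⁻ l, ‖T (v l)‖ₑ ^ 2 ∂μ ≤ ∑' k, ‖adjoint T (c k)‖ₑ ^ 2 := by
  rw [isHilbertSchmidt_iff c] at hT
  -- only countably many terms are nonzero, so that sum and integral can be exchanged
  have hc := Summable.countable_support_ennreal hT.ne
  set S := Function.support fun k => ‖adjoint T (c k)‖ₑ ^ 2 with hS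
  have e : ∀ l, ‖T (v l)‖ₑ ^ 2 = ∑' k : S, ‖inner ℂ (v l) (adjoint T (c k))‖ₑ ^ 2 := by
    intro l
    rw [← tsum_enorm_inner_sq c, ← tsum_subtype_eq_of_support_subset (s := S)]
    · refine tsum_congr fun k => ?_
      rw [adjoint_inner_right, enorm_inner_symm]
    · intro k hk h0
      apply hk
      have h0 : adjoint T (c k) = 0 := by simpa [hS] using h0
      simp only
      rw [← adjoint_inner_left, h0]
      simp
  simp_rw [e]
  have := hc.to_subtype
  rw [lintegral_tsum fun k => ((hm _).enorm.pow_const 2)]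
  calc _ ≤ ∑' k : S, ‖adjoint T (c k)‖ₑ ^ 2 := ENNReal.tsum_le_tsum fun k => hv _
    _ ≤ _ := ENNReal.tsum_comp_le_tsum_of_injective Subtype.val_injective _

/-- If the families `v n` are asymptotically tight frames, the Hilbert–Schmidt norm is bounded by
the square norms of the families `T (v n)`. -/
theorem isHilbertSchmidt_of_frames {ι : Type*} [Fintype ι] (T : E →L[ℂ] F) (v : ℕ → ι → Λ → E)
    (hm : ∀ n j x, AEMeasurable (fun l => inner ℂ (v n j l) x) μ)
    (hv : ∀ x, Filter.Tendsto (fun n => ∑ j, ∫⁻ l, ‖inner ℂ (v n j l) x‖ₑ ^ 2 ∂μ) Filter.atTop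
      (nhds (‖x‖ₑ ^ 2)))
    {C : ℝ≥0∞} (hC : C < ∞) (h : ∀ n, ∑ j, ∫⁻ l, ‖T (v n j l)‖ₑ ^ 2 ∂μ ≤ C) :
    IsHilbertSchmidt T := by
  obtain ⟨w, c, -⟩ := exists_hilbertBasis ℂ F
  rw [isHilbertSchmidt_iff c]
  refine lt_of_le_of_lt ?_ hC
  -- Finite partial sums pass to the limit `n → ∞`, and each is bounded by `C` by Bessel's inequality.
  rw [ENNReal.tsum_eq_iSup_sum]
  refine iSup_le fun s => ?_
  refine le_of_tendsto' (tendsto_finsetSum s fun k _ => hv (adjoint T (c k))) fun n => ?_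
  refine le_trans ?_ (h n)
  rw [Finset.sum_comm]
  refine Finset.sum_le_sum fun j _ => ?_
  rw [← lintegral_finsetSum' _ fun k _ => ((hm _ _ _).enorm.pow_const 2)]
  refine lintegral_mono fun l => ?_
  rw [← tsum_enorm_inner_sq c]
  refine le_trans (le_of_eq ?_) (ENNReal.sum_le_tsum s)
  refine Finset.sum_congr rfl fun k _ => ?_
  rw [adjoint_inner_right, enorm_inner_symm]

end HilbertSchmidt

/-! ### Exponential vectors -/

section Windows

/-- The function `x ↦ exp(2πiqx) w(x)`. -/
def modulate (q : ℝ) (w : ℝ → ℂ) (x : ℝ) : ℂ := (𝐞 (q * x) : ℂ) * w x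

theorem norm_modulate (q : ℝ) (w : ℝ → ℂ) (x : ℝ) : ‖modulate q w x‖ = ‖w x‖ := by
  rw [modulate, norm_mul, Circle.norm_coe, one_mul]

theorem aestronglyMeasurable_modulate {w : ℝ → ℂ} (hw : AEStronglyMeasurable w) (q : ℝ) :
    AEStronglyMeasurable (modulate q w) := by
  refine AEStronglyMeasurable.mul (Continuous.aestronglyMeasurable ?_) hw
  fun_prop

theorem memLp_modulate {w : ℝ → ℂ} {p : ℝ≥0∞} (hw : MemLp w p) (q : ℝ) :
    MemLp (modulate q w) p :=
  hw.of_le (aestronglyMeasurable_modulate hw.1 q)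
    (Filter.Eventually.of_forall fun x => (norm_modulate q w x).le)

variable {N : ℕ}

theorem memLp_smul_const {g : ℝ → ℂ} {p : ℝ≥0∞} (hg : MemLp g p) (c : EuclideanSpace ℂ (Fin N)) :
    MemLp (fun x => g x • c) p :=
  (hg.norm.mul_const ‖c‖).of_le (hg.1.smul_const c)
    (Filter.Eventually.of_forall fun x => by simp [norm_smul])

/-- The vector `g ⊗ c` of `L²(ℝ, ℂᴺ)`. -/
def tensor {g : ℝ → ℂ} (hg : MemLp g 2) (c : EuclideanSpace ℂ (Fin N)) : L2Line N :=
  (memLp_smul_const hg c).toLp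

theorem coeFn_tensor {g : ℝ → ℂ} (hg : MemLp g 2) (c : EuclideanSpace ℂ (Fin N)) :
    tensor hg c =ᵐ[volume] fun x => g x • c :=
  (memLp_smul_const hg c).coeFn_toLp

theorem coeFn_fourier_tensor {g : ℝ → ℂ} (h1 : Integrable g) (hg : MemLp g 2)
    (c : EuclideanSpace ℂ (Fin N)) :
    (𝓕 (tensor hg c) : L2Line N) =ᵐ[volume] fun ξ => 𝓕 g ξ • c := by
  have h := coeFn_fourier_toLp (h1.smul_const c) (memLp_smul_const hg c)
  refine h.trans (Filter.Eventually.of_forall fun ξ => ?_)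
  simp only [Real.fourier_real_eq]
  rw [← integral_smul_const]
  simp [smul_smul, Circle.smul_def]

theorem measurable_coord (f : L2Line N) (j : Fin N) :
    StronglyMeasurable fun x => f x j :=
  (EuclideanSpace.proj (𝕜 := ℂ) j).continuous.comp_stronglyMeasurable (Lp.stronglyMeasurable f)

theorem memLp_coord (f : L2Line N) (j : Fin N) : MemLp (fun x => f x j) 2 :=
  (Lp.memLp f).of_le (measurable_coord f j).aestronglyMeasurable
    (Filter.Eventually.of_forall fun x => PiLp.norm_apply_le (f x) j)

/-- Pairing with the modulations of a window is a windowed Fourier transform. -/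
theorem inner_modulate_tensor {w : ℝ → ℂ} (hw : MemLp w 2) (q : ℝ) (j : Fin N) (f : L2Line N) :
    inner ℂ (tensor (memLp_modulate hw q) (EuclideanSpace.single j 1)) f =
      𝓕 (fun x => star (w x) * f x j) q := by
  rw [L2.inner_def, Real.fourier_real_eq]
  refine integral_congr_ae ?_
  filter_upwards [coeFn_tensor (memLp_modulate hw q) (EuclideanSpace.single j 1)] with x hx
  rw [hx, inner_smul_left, EuclideanSpace.inner_single_left, Circle.smul_def]
  simp only [modulate, map_mul, map_one, one_mul, AddChar.map_neg_eq_inv, Circle.coe_inv_eq_conj,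
    smul_eq_mul, mul_comm x q, mul_assoc]
  rfl

theorem integrable_star_mul_coord {w : ℝ → ℂ} (hw : MemLp w 2) (j : Fin N) (f : L2Line N) :
    Integrable fun x => star (w x) * f x j :=
  MemLp.integrable_mul hw.star (memLp_coord f j)

theorem measurable_inner_modulate_tensor {w : ℝ → ℂ} (hw : MemLp w 2) (j : Fin N) (f : L2Line N) :
    Measurable fun q =>
      inner ℂ (tensor (memLp_modulate hw q) (EuclideanSpace.single j 1)) f := by
  rw [funext fun q => inner_modulate_tensor hw q j f]
  exact (continuous_fourier_of_integrable (integrable_star_mul_coord hw j f)).measurable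

/-- The modulations of a window `w` resolve the multiplication by `|w|²`, by Plancherel's identity. -/
theorem lintegral_inner_modulate_tensor {w : ℝ → ℂ} (hw : MemLp w 2) {C : ℝ}
    (hC : ∀ x, ‖w x‖ ≤ C) (j : Fin N) (f : L2Line N) :
    ∫⁻ q, ‖inner ℂ (tensor (memLp_modulate hw q) (EuclideanSpace.single j 1)) f‖ₑ ^ 2 =
      ∫⁻ x, ‖w x‖ₑ ^ 2 * ‖f x j‖ₑ ^ 2 := by
  rw [lintegral_congr fun q => by rw [inner_modulate_tensor hw q j f],
    lintegral_enorm_fourier_sq (integrable_star_mul_coord hw j f)]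
  · simp [enorm_mul, mul_pow]
  · have hs : MemLp (fun x => star (w x)) ∞ :=
      memLp_top_of_bound hw.1.star C (Filter.Eventually.of_forall fun x => by simpa using hC x)
    exact MemLp.mul (memLp_coord f j) hs

theorem sum_enorm_coord_sq (v : EuclideanSpace ℂ (Fin N)) : ∑ j, ‖v j‖ₑ ^ 2 = ‖v‖ₑ ^ 2 := by
  simp_rw [← ofReal_norm, ← ENNReal.ofReal_pow (norm_nonneg _)]
  rw [EuclideanSpace.norm_sq_eq, ENNReal.ofReal_sum_of_nonneg fun _ _ => by positivity]

/-- The window `exp(-2πεx)` on the half-line `(0,∞)`. -/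
def halfWindow (ε : ℝ) : ℝ → ℂ :=
  Set.indicator (Set.Ioi 0) fun x => Complex.exp ((-(2 * Real.pi * ε) : ℝ) * x)

theorem halfWindow_of_nonpos (ε : ℝ) {x : ℝ} (hx : x ≤ 0) : halfWindow ε x = 0 :=
  Set.indicator_of_notMem (by simpa using hx) _

theorem halfWindow_of_pos (ε : ℝ) {x : ℝ} (hx : 0 < x) :
    halfWindow ε x = Complex.exp ((-(2 * Real.pi * ε) : ℝ) * x) :=
  Set.indicator_of_mem (by simpa using hx) _

theorem norm_halfWindow_le {ε : ℝ} (hε : 0 < ε) (x : ℝ) : ‖halfWindow ε x‖ ≤ 1 := by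
  rcases le_or_gt x 0 with hx | hx
  · simp [halfWindow_of_nonpos ε hx]
  · rw [halfWindow_of_pos ε hx, Complex.norm_exp, Real.exp_le_one_iff]
    norm_cast
    nlinarith [Real.pi_pos, mul_pos (mul_pos Real.pi_pos hε) hx]

theorem integrable_halfWindow {ε : ℝ} (hε : 0 < ε) : Integrable (halfWindow ε) := by
  rw [halfWindow, integrable_indicator_iff measurableSet_Ioi]
  refine integrableOn_exp_mul_complex_Ioi ?_ 0
  rw [Complex.ofReal_re]
  nlinarith [Real.pi_pos, mul_pos Real.pi_pos hε]

theorem memLp_two_of_integrable_of_bound {w : ℝ → ℂ} (h : Integrable w) {C : ℝ}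
    (hC : ∀ x, ‖w x‖ ≤ C) : MemLp w 2 := by
  rw [memLp_two_iff_integrable_sq_norm h.1]
  simp_rw [pow_two]
  exact h.norm.bdd_mul h.1.norm (Filter.Eventually.of_forall fun x => by simpa using hC x)

theorem memLp_halfWindow {ε : ℝ} (hε : 0 < ε) : MemLp (halfWindow ε) 2 :=
  memLp_two_of_integrable_of_bound (integrable_halfWindow hε) (norm_halfWindow_le hε)

theorem memLp_halfWindow_neg {ε : ℝ} (hε : 0 < ε) : MemLp (fun x => halfWindow ε (-x)) 2 :=
  memLp_two_of_integrable_of_bound (integrable_halfWindow hε).comp_neg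
    fun x => norm_halfWindow_le hε (-x)

/-- The Fourier transform of a half-line window is a Cauchy kernel. -/
theorem fourier_modulate_halfWindow {ε : ℝ} (hε : 0 < ε) (q s : ℝ) :
    𝓕 (modulate q (halfWindow ε)) s = (2 * Real.pi * (ε + Complex.I * (s - q)))⁻¹ := by
  have hre : (-(2 * Real.pi * (ε + Complex.I * (s - q))) : ℂ).re < 0 := by
    have : (-(2 * Real.pi * (ε + Complex.I * (s - q))) : ℂ).re = -(2 * Real.pi * ε) := by
      simp
    rw [this]
    nlinarith [Real.pi_pos, mul_pos Real.pi_pos hε]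
  have h := integral_exp_mul_complex_Ioi hre 0
  rw [Real.fourier_real_eq]
  trans ∫ x in Set.Ioi (0 : ℝ), Complex.exp (-(2 * Real.pi * (ε + Complex.I * (s - q))) * x)
  · rw [← integral_indicator measurableSet_Ioi]
    refine integral_congr_ae (Filter.Eventually.of_forall fun x => ?_)
    rcases le_or_gt x 0 with hx | hx
    · simp [modulate, halfWindow_of_nonpos ε hx, hx]
    · simp only [modulate, halfWindow_of_pos ε hx, Circle.smul_def, Real.fourierChar_apply,
        Set.indicator_of_mem (Set.mem_Ioi.2 hx), smul_eq_mul, ← Complex.exp_add]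
      congr 1
      push_cast
      ring
  · rw [h]
    have : (2 * Real.pi * (ε + Complex.I * (s - q)) : ℂ) ≠ 0 := fun h0 => by
      rw [h0] at hre; simp at hre
    simp [div_eq_mul_inv, inv_neg]

theorem fourier_modulate_halfWindow_neg {ε : ℝ} (hε : 0 < ε) (q s : ℝ) :
    𝓕 (modulate q fun x => halfWindow ε (-x)) s =
      (2 * Real.pi * (ε - Complex.I * (s - q)))⁻¹ := by
  have h := fourier_modulate_halfWindow hε (-q) (-s)
  rw [Real.fourier_real_eq, ← integral_neg_eq_self] at h
  rw [Real.fourier_real_eq]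
  convert! h using 3
  · simp [modulate]
  · push_cast; ring

end Windows

/-! ### Finite energy implies Hilbert–Schmidt -/

section HardyVectors
variable {N : ℕ}

/-- The Gagliardo energy `∫∫ |f(p) - f(q)|² / |p - q|² dp dq`. -/
def energy (f : ℝ → ℂ) : ℝ≥0∞ := ∫⁻ q, ∫⁻ p, ‖f p - f q‖ₑ ^ 2 / ‖p - q‖ₑ ^ 2

theorem tensor_right_mem {ε : ℝ} (hε : 0 < ε) (q : ℝ) (c : EuclideanSpace ℂ (Fin N)) :
    tensor (memLp_modulate (memLp_halfWindow hε) q) c ∈ halfLine N := by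
  rw [mem_halfLine_iff, ae_restrict_iff' measurableSet_Iic]
  filter_upwards [coeFn_tensor (memLp_modulate (memLp_halfWindow hε) q) c] with x hx h0
  rw [hx, modulate, halfWindow_of_nonpos ε h0]
  simp

theorem tensor_left_mem {ε : ℝ} (hε : 0 < ε) (q : ℝ) (c : EuclideanSpace ℂ (Fin N)) :
    tensor (memLp_modulate (memLp_halfWindow_neg hε) q) c ∈ (halfLine N)ᗮ := by
  rw [Submodule.mem_orthogonal]
  intro f hf
  rw [mem_halfLine_iff, ae_restrict_iff' measurableSet_Iic] at hf
  rw [L2.inner_def]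
  refine integral_eq_zero_of_ae ?_
  filter_upwards [hf, coeFn_tensor (memLp_modulate (memLp_halfWindow_neg hε) q) c] with x hf hx
  rcases le_or_gt x 0 with h0 | h0
  · simp [hf h0]
  · rw [hx, modulate, halfWindow_of_nonpos ε (by linarith)]
    simp

/-- The vector `exp(2πiqx - 2πεx) 1_{x>0} ⊗ c` of `K`, whose Fourier transform is a reproducing
kernel of the Hardy space. -/
def rightVec {ε : ℝ} (hε : 0 < ε) (c : EuclideanSpace ℂ (Fin N)) (q : ℝ) : halfLine N :=
  ⟨_, tensor_right_mem hε q c⟩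

/-- The vector `exp(2πiqx + 2πεx) 1_{x<0} ⊗ c` of `Kᗮ`. -/
def leftVec {ε : ℝ} (hε : 0 < ε) (c : EuclideanSpace ℂ (Fin N)) (q : ℝ) : (halfLine N)ᗮ :=
  ⟨_, tensor_left_mem hε q c⟩

theorem fourier_rightVec {ε : ℝ} (hε : 0 < ε) (c : EuclideanSpace ℂ (Fin N)) (q : ℝ) :
    (𝓕 (rightVec hε c q : L2Line N) : L2Line N) =ᵐ[volume]
      fun s => (2 * Real.pi * (ε + Complex.I * (s - q)) : ℂ)⁻¹ • c := by
  have h1 : Integrable (modulate q (halfWindow ε)) :=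
    memLp_one_iff_integrable.1 (memLp_modulate
      (memLp_one_iff_integrable.2 (integrable_halfWindow hε)) q)
  filter_upwards [coeFn_fourier_tensor h1 (memLp_modulate (memLp_halfWindow hε) q) c] with s hs
  rw [← fourier_modulate_halfWindow hε, ← hs]
  rfl

theorem fourier_leftVec {ε : ℝ} (hε : 0 < ε) (c : EuclideanSpace ℂ (Fin N)) (q : ℝ) :
    (𝓕 (leftVec hε c q : L2Line N) : L2Line N) =ᵐ[volume]
      fun s => (2 * Real.pi * (ε - Complex.I * (s - q)) : ℂ)⁻¹ • c := by
  have h1 : Integrable (modulate q fun x => halfWindow ε (-x)) :=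
    memLp_one_iff_integrable.1 (memLp_modulate
      (memLp_one_iff_integrable.2 (integrable_halfWindow hε).comp_neg) q)
  filter_upwards [coeFn_fourier_tensor h1 (memLp_modulate (memLp_halfWindow_neg hε) q) c] with s hs
  rw [← fourier_modulate_halfWindow_neg hε, ← hs]
  rfl

theorem measurable_inner_rightVec {ε : ℝ} (hε : 0 < ε) (j : Fin N) (f : halfLine N) :
    Measurable fun q => inner ℂ (rightVec hε (EuclideanSpace.single j 1) q) f :=
  measurable_inner_modulate_tensor (memLp_halfWindow hε) j (f : L2Line N)

theorem lintegral_window_mul_coord_le {w : ℝ → ℂ} (hw : ∀ x, ‖w x‖ ≤ 1) (j : Fin N)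
    (f : L2Line N) : ∫⁻ x, ‖w x‖ₑ ^ 2 * ‖f x j‖ₑ ^ 2 ≤ ‖f‖ₑ ^ 2 := by
  rw [← lintegral_enorm_sq_eq_enorm_sq]
  refine lintegral_mono fun x => ?_
  have h1 : ‖w x‖ₑ ≤ 1 := by
    rw [← ofReal_norm]; exact ENNReal.ofReal_le_one.2 (hw x)
  have h2 : ‖f x j‖ₑ ≤ ‖f x‖ₑ := enorm_le_iff_norm_le.2 (PiLp.norm_apply_le (f x) j)
  calc ‖w x‖ₑ ^ 2 * ‖f x j‖ₑ ^ 2 ≤ 1 ^ 2 * ‖f x‖ₑ ^ 2 := by gcongr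
    _ = _ := by simp

/-- The vectors `rightVec` satisfy Bessel's inequality. -/
theorem lintegral_inner_rightVec_le {ε : ℝ} (hε : 0 < ε) (j : Fin N) (f : halfLine N) :
    ∫⁻ q, ‖inner ℂ (rightVec hε (EuclideanSpace.single j 1) q) f‖ₑ ^ 2 ≤ ‖f‖ₑ ^ 2 :=
  (lintegral_inner_modulate_tensor (memLp_halfWindow hε) (norm_halfWindow_le hε) j
    (f : L2Line N)).trans_le
      (lintegral_window_mul_coord_le (norm_halfWindow_le hε) j (f : L2Line N))

theorem lintegral_inner_leftVec_le {ε : ℝ} (hε : 0 < ε) (j : Fin N) (f : (halfLine N)ᗮ) :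
    ∫⁻ q, ‖inner ℂ (leftVec hε (EuclideanSpace.single j 1) q) f‖ₑ ^ 2 ≤ ‖f‖ₑ ^ 2 :=
  (lintegral_inner_modulate_tensor (memLp_halfWindow_neg hε)
    (fun x => norm_halfWindow_le hε (-x)) j (f : L2Line N)).trans_le
      (lintegral_window_mul_coord_le (fun x => norm_halfWindow_le hε (-x)) j (f : L2Line N))

theorem halfWindow_measurable (ε : ℝ) : Measurable (halfWindow ε) :=
  (Continuous.measurable (by fun_prop)).indicator measurableSet_Ioi

/-- The vectors `rightVec` become a tight frame of `K` as `ε → 0`. -/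
theorem tendsto_lintegral_inner_rightVec {ε : ℕ → ℝ} (hε : ∀ n, 0 < ε n)
    (h0 : Filter.Tendsto ε Filter.atTop (nhds 0)) (f : halfLine N) :
    Filter.Tendsto (fun n => ∑ j, ∫⁻ q,
        ‖inner ℂ (rightVec (hε n) (EuclideanSpace.single j 1) q) f‖ₑ ^ 2)
      Filter.atTop (nhds (‖f‖ₑ ^ 2)) := by
  have e : ∀ n, ∑ j, ∫⁻ q, ‖inner ℂ (rightVec (hε n) (EuclideanSpace.single j 1) q) f‖ₑ ^ 2 =
      ∫⁻ x, ‖halfWindow (ε n) x‖ₑ ^ 2 * ‖(f : L2Line N) x‖ₑ ^ 2 := by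
    intro n
    simp_rw [← sum_enorm_coord_sq, Finset.mul_sum]
    rw [lintegral_finsetSum]
    · refine Finset.sum_congr rfl fun j _ => ?_
      exact lintegral_inner_modulate_tensor (memLp_halfWindow (hε n))
        (norm_halfWindow_le (hε n)) j (f : L2Line N)
    · intro j _
      exact ((halfWindow_measurable _).enorm.pow_const 2).mul
        ((measurable_coord (f : L2Line N) j).measurable.enorm.pow_const 2)
  simp_rw [e]
  have hf : ‖f‖ₑ ^ 2 = ∫⁻ x, ‖(f : L2Line N) x‖ₑ ^ 2 := by
    rw [lintegral_enorm_sq_eq_enorm_sq]; rfl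
  have hfm : Measurable fun x => ‖(f : L2Line N) x‖ₑ ^ 2 :=
    ((Lp.stronglyMeasurable (f : L2Line N)).enorm).pow_const 2
  rw [hf]
  refine tendsto_lintegral_of_dominated_convergence (fun x => ‖(f : L2Line N) x‖ₑ ^ 2)
    (fun n => ((halfWindow_measurable _).enorm.pow_const 2).mul hfm) (fun n => ?_) ?_ ?_
  · refine Filter.Eventually.of_forall fun x => ?_
    have h1 : ‖halfWindow (ε n) x‖ₑ ≤ 1 := by
      rw [← ofReal_norm]; exact ENNReal.ofReal_le_one.2 (norm_halfWindow_le (hε n) x)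
    calc ‖halfWindow (ε n) x‖ₑ ^ 2 * ‖(f : L2Line N) x‖ₑ ^ 2 ≤ 1 ^ 2 * ‖(f : L2Line N) x‖ₑ ^ 2 := by gcongr
      _ = _ := by simp
  · rw [← hf]; simp
  · have hm := (mem_halfLine_iff N (f : L2Line N)).1 f.2
    rw [ae_restrict_iff' measurableSet_Iic] at hm
    filter_upwards [hm] with x hx
    rcases le_or_gt x 0 with h | h
    · simp [hx h]
    · have hw : Filter.Tendsto (fun n => halfWindow (ε n) x) Filter.atTop (nhds 1) := by
        simp_rw [halfWindow_of_pos _ h]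
        have hc : Continuous fun t : ℝ => Complex.exp ((-(2 * Real.pi * t) : ℝ) * x) := by fun_prop
        have := (hc.tendsto 0).comp h0
        simpa [Function.comp_def] using this
      have h2 : Filter.Tendsto (fun n => ‖halfWindow (ε n) x‖ₑ ^ 2) Filter.atTop (nhds 1) := by
        simpa [Function.comp_def] using ((ENNReal.continuous_pow 2).tendsto _).comp hw.enorm
      simpa using ENNReal.Tendsto.mul_const h2 (Or.inl one_ne_zero)

/-- The Hankel operator sends the exponential vector at frequency `q` to a vector of norm at most the
inner integral of the energy at `q`: subtracting `Φ(q)` from the symbol changes nothing, and the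
Fourier transform of the vector is bounded by `|s - q|⁻¹`, uniformly in `ε`. -/
theorem enorm_hankel_rightVec_le (Φ : MatrixSymbol N) {ε : ℝ} (hε : 0 < ε) (j : Fin N) (q : ℝ) :
    ‖hankel Φ (rightVec hε (EuclideanSpace.single j 1) q)‖ₑ ^ 2 ≤
      ∫⁻ s, ∑ i, ‖Φ (2 * Real.pi * s) i j - Φ (2 * Real.pi * q) i j‖ₑ ^ 2 / ‖s - q‖ₑ ^ 2 := by
  set e : EuclideanSpace ℂ (Fin N) := EuclideanSpace.single j 1
  set A := Φ (2 * Real.pi * q)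
  -- subtracting the constant value `Φ(q)` of the symbol does not change the projection to `Kᗮ`
  set z := rightVec hε (WithLp.toLp 2 (A.mulVec e.ofLp)) q
  set d : L2Line N := fourierMultiplier Φ (rightVec hε e q) - z
  have hz : (halfLine N)ᗮ.orthogonalProjectionOnto (z : L2Line N) = 0 :=
    Submodule.orthogonalProjectionOnto_orthogonal_apply_eq_zero z.2
  have h1 : hankel Φ (rightVec hε e q) = (halfLine N)ᗮ.orthogonalProjectionOnto d := by
    rw [map_sub, hz, sub_zero]
    rfl
  have h2 : ‖hankel Φ (rightVec hε e q)‖ₑ ≤ ‖(𝓕 d : L2Line N)‖ₑ := by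
    rw [enorm_le_iff_norm_le, Lp.norm_fourier_eq, h1]
    exact Submodule.norm_orthogonalProjectionOnto_apply_le _ _
  refine (pow_le_pow_left' h2 2).trans ?_
  rw [← lintegral_enorm_sq_eq_enorm_sq]
  refine lintegral_mono_ae ?_
  have h3 : (𝓕 d : L2Line N) = 𝓕 (fourierMultiplier Φ (rightVec hε e q)) - 𝓕 (z : L2Line N) :=
    map_sub (Lp.fourierTransformₗᵢ ℝ (EuclideanSpace ℂ (Fin N))) _ _
  rw [h3]
  filter_upwards [Lp.coeFn_sub (𝓕 (fourierMultiplier Φ (rightVec hε e q))) (𝓕 (z : L2Line N)),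
    fourier_fourierMultiplier Φ (rightVec hε e q), fourier_rightVec hε e q,
    fourier_rightVec hε (WithLp.toLp 2 (A.mulVec e.ofLp)) q] with s a1 a2 a3 a4
  rw [a1, Pi.sub_apply, a2, a3, a4, ← sum_enorm_coord_sq]
  refine Finset.sum_le_sum fun i _ => ?_
  set k : ℂ := (2 * Real.pi * (ε + Complex.I * (s - q)))⁻¹ with hk
  have hv : (WithLp.toLp 2 (Matrix.mulVec (Φ (2 * Real.pi * s)) (k • e).ofLp) -
      k • WithLp.toLp 2 (A.mulVec e.ofLp) : EuclideanSpace ℂ (Fin N)) i =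
        (Φ (2 * Real.pi * s) i j - A i j) * k := by
    simp [e, Matrix.mulVec_smul]
    ring
  rw [hv, enorm_mul, mul_pow, div_eq_mul_inv]
  gcongr
  rw [hk, enorm_inv, ← ENNReal.inv_pow]
  · gcongr
    rw [enorm_le_iff_norm_le, norm_mul]
    have h5 : |s - q| ≤ ‖(ε + Complex.I * (s - q) : ℂ)‖ := by
      have := Complex.abs_im_le_norm (ε + Complex.I * (s - q) : ℂ)
      simpa using this
    have h6 : (1 : ℝ) ≤ ‖(2 * Real.pi : ℂ)‖ := by
      rw [norm_mul, Complex.norm_real, Real.norm_of_nonneg Real.pi_pos.le]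
      simp
      linarith [Real.pi_gt_three]
    rw [Real.norm_eq_abs]
    nlinarith [abs_nonneg (s - q)]
  · intro h0
    have := congrArg Complex.re h0
    simp [Real.pi_ne_zero, hε.ne'] at this

theorem measurable_symbol (Φ : MatrixSymbol N) (i j : Fin N) : Measurable fun p => Φ p i j := by
  have h : Continuous fun A : Matrix (Fin N) (Fin N) ℂ => A i j :=
    (LinearMap.toContinuousLinearMap (Matrix.entryLinearMap ℂ ℂ i j)).continuous
  exact (h.comp_stronglyMeasurable (Lp.stronglyMeasurable Φ)).measurable

theorem measurable_symbol_rescale (Φ : MatrixSymbol N) (i j : Fin N) :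
    Measurable fun s => Φ (2 * Real.pi * s) i j :=
  (measurable_symbol Φ i j).comp (measurable_const_mul _)

theorem lintegral_lintegral_finsetSum {ι : Type*} [Fintype ι] {G : ι → ℝ × ℝ → ℝ≥0∞}
    (hm : ∀ i, Measurable (G i)) :
    ∫⁻ q, ∫⁻ s, ∑ i, G i (q, s) = ∑ i, ∫⁻ q, ∫⁻ s, G i (q, s) := by
  rw [← lintegral_finsetSum _ fun i _ => (hm i).lintegral_prod_right']
  refine lintegral_congr fun q => ?_
  exact lintegral_finsetSum _ fun i _ => (hm i).comp measurable_prodMk_left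

/-- A symbol of finite energy has a Hilbert–Schmidt Hankel operator. -/
theorem isHilbertSchmidt_hankel_of_energy (Φ : MatrixSymbol N)
    (h : ∀ i j, energy (fun s => Φ (2 * Real.pi * s) i j) < ∞) : IsHilbertSchmidt (hankel Φ) := by
  have hε : ∀ n : ℕ, (0 : ℝ) < 1 / ((n : ℝ) + 1) := fun n => by positivity
  refine isHilbertSchmidt_of_frames (μ := volume) (hankel Φ)
    (fun n j q => rightVec (hε n) (EuclideanSpace.single j 1) q)
    (fun n j x => (measurable_inner_rightVec (hε n) j x).aemeasurable)
    (tendsto_lintegral_inner_rightVec hε tendsto_one_div_add_atTop_nhds_zero_nat)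
    (C := ∑ j, ∑ i, energy (fun s => Φ (2 * Real.pi * s) i j)) ?_ fun n => ?_
  · simp only [ENNReal.sum_lt_top]
    exact fun j _ i _ => h i j
  · refine Finset.sum_le_sum fun j _ => ?_
    refine (lintegral_mono fun q => enorm_hankel_rightVec_le Φ (hε n) j q).trans ?_
    have hm : ∀ i, Measurable fun z : ℝ × ℝ =>
        ‖Φ (2 * Real.pi * z.2) i j - Φ (2 * Real.pi * z.1) i j‖ₑ ^ 2 / ‖z.2 - z.1‖ₑ ^ 2 := by
      intro i
      have hm := measurable_symbol_rescale Φ i j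
      exact (((hm.comp measurable_snd).sub (hm.comp measurable_fst)).enorm.pow_const 2).div
        ((measurable_snd.sub measurable_fst).enorm.pow_const 2)
    exact (lintegral_lintegral_finsetSum hm).le

end HardyVectors

/-! ### Cauchy and Poisson kernels -/

section Poisson
open Filter Topology

theorem lintegral_comp_mul_left {a : ℝ} (ha : a ≠ 0) (f : ℝ → ℝ≥0∞) :
    ∫⁻ x, f (a * x) = ENNReal.ofReal |a⁻¹| * ∫⁻ x, f x := by
  have h := (Homeomorph.mulLeft₀ a ha).measurableEmbedding.lintegral_map (μ := volume) f
  have e : Measure.map (Homeomorph.mulLeft₀ a ha) (volume : Measure ℝ) =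
      ENNReal.ofReal |a⁻¹| • volume := Real.map_volume_mul_left ha
  rw [e, lintegral_smul_measure] at h
  exact h.symm

theorem lintegral_comp_add_mul {a : ℝ} (ha : 0 < a) (p : ℝ) (f : ℝ → ℝ≥0∞) :
    ∫⁻ x, f (p + a * x) = ENNReal.ofReal a⁻¹ * ∫⁻ x, f x := by
  rw [lintegral_comp_mul_left ha.ne' fun x => f (p + x), lintegral_add_left_eq_self,
    abs_of_pos (inv_pos.2 ha)]

/-- The layer-cake formula for the Poisson kernel. -/
theorem lintegral_poisson_layer (t : ℝ) :
    ENNReal.ofReal (1 + t ^ 2)⁻¹ =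
      ∫⁻ r in Set.Ioi |t|, ENNReal.ofReal (2 * r / (1 + r ^ 2) ^ 2) := by
  have hd : ∀ x ∈ Set.Ioi |t|, HasDerivAt (fun r : ℝ => -(1 + r ^ 2)⁻¹)
      (2 * x / (1 + x ^ 2) ^ 2) x := by
    intro x _
    have h := (((hasDerivAt_pow 2 x).const_add 1).fun_inv (by positivity)).fun_neg
    convert! h using 1
    simp
    ring
  have hc : ContinuousWithinAt (fun r : ℝ => -(1 + r ^ 2)⁻¹) (Set.Ici |t|) |t| := by
    refine Continuous.continuousWithinAt (Continuous.neg (Continuous.inv₀ (by fun_prop) ?_))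
    intro x; positivity
  have hp : ∀ x ∈ Set.Ioi |t|, 0 ≤ 2 * x / (1 + x ^ 2) ^ 2 := fun x hx => by
    have := (abs_nonneg t).trans hx.out.le
    positivity
  have hl : Tendsto (fun r : ℝ => -(1 + r ^ 2)⁻¹) atTop (𝓝 0) := by
    rw [← neg_zero]
    exact (tendsto_inv_atTop_zero.comp
      (tendsto_atTop_add_const_left _ 1 (tendsto_pow_atTop two_ne_zero))).neg
  rw [← ofReal_integral_eq_lintegral_ofReal (integrableOn_Ioi_deriv_of_nonneg hc hd hp hl)
    ((ae_restrict_iff' measurableSet_Ioi).2 (Eventually.of_forall hp)),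
    integral_Ioi_of_hasDerivAt_of_nonneg hc hd hp hl]
  simp

/-- At almost every point the Poisson means of `|f - f p|` tend to zero. -/
theorem tendsto_poisson_error {f : ℝ → ℂ} (hf : Measurable f) {M : ℝ} (hM : ∀ᵐ x, ‖f x‖ ≤ M)
    {ε : ℕ → ℝ} (hε : ∀ n, 0 < ε n) (h0 : Tendsto ε atTop (𝓝 0)) :
    ∀ᵐ p, Tendsto (fun n => ∫⁻ t, ENNReal.ofReal (1 + t ^ 2)⁻¹ * ‖f (p + ε n * t) - f p‖ₑ)
      atTop (𝓝 0) := by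
  have hloc : LocallyIntegrable f :=
    (memLp_top_of_bound hf.aestronglyMeasurable M hM).locallyIntegrable le_top
  filter_upwards [(Besicovitch.vitaliFamily (volume : Measure ℝ)).ae_tendsto_lintegral_enorm_sub_div
    hloc, hM] with p hp hMp
  replace hp := hp.comp (Besicovitch.tendsto_filterAt volume p)
  set A : ℝ → ℝ≥0∞ := fun r =>
    (∫⁻ y in Metric.closedBall p r, ‖f y - f p‖ₑ) / volume (Metric.closedBall p r) with hA
  have hAle : ∀ r, A r ≤ ENNReal.ofReal (2 * M) := by
    intro r
    refine ENNReal.div_le_of_le_mul ?_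
    rw [← setLIntegral_const]
    refine lintegral_mono_ae (ae_restrict_of_ae ?_)
    filter_upwards [hM] with y hy
    rw [← ofReal_norm]
    refine ENNReal.ofReal_le_ofReal ((norm_sub_le _ _).trans ?_)
    linarith
  have hgm : ∀ n, Measurable fun t => ‖f (p + ε n * t) - f p‖ₑ := fun n => by fun_prop
  -- the inner average, rescaled
  have hin : ∀ n, ∀ r > 0, ∫⁻ t in {t | |t| < r}, ‖f (p + ε n * t) - f p‖ₑ ≤
      ENNReal.ofReal (2 * r) * A (ε n * r) := by
    intro n r hr
    have hs : MeasurableSet {t : ℝ | |t| < r} := measurableSet_lt (by fun_prop) (by fun_prop)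
    rw [← lintegral_indicator hs]
    have h1 : ∀ t, {t : ℝ | |t| < r}.indicator (fun t => ‖f (p + ε n * t) - f p‖ₑ) t ≤
        (Metric.closedBall p (ε n * r)).indicator (fun y => ‖f y - f p‖ₑ) (p + ε n * t) := by
      intro t
      by_cases ht : |t| < r
      · rw [Set.indicator_of_mem (by exact ht), Set.indicator_of_mem]
        simp [abs_of_pos (hε n), (hε n), ht.le]
      · rw [Set.indicator_of_notMem (by exact ht)]
        exact bot_le
    refine (lintegral_mono h1).trans ?_
    rw [lintegral_comp_add_mul (hε n), lintegral_indicator Metric.isClosed_closedBall.measurableSet]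
    have hpos : 0 < ε n * r := mul_pos (hε n) hr
    have hv : volume (Metric.closedBall p (ε n * r)) ≠ 0 := by
      rw [Real.volume_closedBall]; simpa using hpos
    have hv' : volume (Metric.closedBall p (ε n * r)) ≠ ∞ := by
      rw [Real.volume_closedBall]; exact ENNReal.ofReal_ne_top
    rw [hA]
    simp only
    rw [← ENNReal.mul_div_cancel hv hv' (b := ∫⁻ y in Metric.closedBall p (ε n * r), ‖f y - f p‖ₑ),
      ← mul_assoc]
    refine mul_le_mul' (le_of_eq ?_) (le_of_eq ?_)
    · rw [Real.volume_closedBall, ← ENNReal.ofReal_mul (inv_pos.2 (hε n)).le]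
      congr 1
      have := (hε n).ne'
      field_simp
    · rw [ENNReal.mul_div_cancel hv hv']
  have hbound : ∀ n, ∫⁻ t, ENNReal.ofReal (1 + t ^ 2)⁻¹ * ‖f (p + ε n * t) - f p‖ₑ ≤
      ∫⁻ r in Set.Ioi (0 : ℝ), ENNReal.ofReal (2 * r / (1 + r ^ 2) ^ 2) *
        (ENNReal.ofReal (2 * r) * A (ε n * r)) := by
    intro n
    set κ : ℝ → ℝ≥0∞ := fun r => ENNReal.ofReal (2 * r / (1 + r ^ 2) ^ 2)
    have hκ : Measurable κ := by fun_prop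
    have hS : MeasurableSet {z : ℝ × ℝ | |z.1| < z.2} :=
      measurableSet_lt (by fun_prop) (by fun_prop)
    calc ∫⁻ t, ENNReal.ofReal (1 + t ^ 2)⁻¹ * ‖f (p + ε n * t) - f p‖ₑ
        = ∫⁻ t, ∫⁻ r, {z : ℝ × ℝ | |z.1| < z.2}.indicator
            (fun z => κ z.2 * ‖f (p + ε n * z.1) - f p‖ₑ) (t, r) := by
          refine lintegral_congr fun t => ?_
          rw [lintegral_poisson_layer, ← lintegral_mul_const _ hκ,
            ← lintegral_indicator measurableSet_Ioi]
          refine lintegral_congr fun r => ?_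
          simp [Set.indicator_apply, κ]
      _ = ∫⁻ r, ∫⁻ t, {z : ℝ × ℝ | |z.1| < z.2}.indicator
            (fun z => κ z.2 * ‖f (p + ε n * z.1) - f p‖ₑ) (t, r) := by
          refine lintegral_lintegral_swap (Measurable.aemeasurable ?_)
          exact ((hκ.comp measurable_snd).mul ((hgm n).comp measurable_fst)).indicator hS
      _ ≤ ∫⁻ r in Set.Ioi (0 : ℝ), κ r * (ENNReal.ofReal (2 * r) * A (ε n * r)) := by
          rw [← lintegral_indicator measurableSet_Ioi]
          refine lintegral_mono fun r => ?_
          rcases le_or_gt r 0 with hr | hr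
          · refine le_of_eq_of_le ?_ bot_le
            rw [bot_eq_zero]
            refine lintegral_eq_zero_of_ae_eq_zero (Eventually.of_forall fun t => ?_)
            exact Set.indicator_of_notMem (by
              simpa using hr.trans (abs_nonneg t)) _
          · rw [Set.indicator_of_mem (Set.mem_Ioi.2 hr)]
            refine le_trans (le_of_eq ?_) (mul_le_mul_right (hin n r hr) _)
            rw [← lintegral_indicator (measurableSet_lt (by fun_prop) (by fun_prop)),
              ← lintegral_const_mul _ ((hgm n).indicator
                (measurableSet_lt (by fun_prop) (by fun_prop)))]
            refine lintegral_congr fun t => ?_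
            simp [Set.indicator_apply]
  have hAm : ∀ n, AEMeasurable (fun r => A (ε n * r)) (volume.restrict (Set.Ioi 0)) := by
    intro n
    have h1 : Measurable fun r => ∫⁻ y in Metric.closedBall p r, ‖f y - f p‖ₑ :=
      Monotone.measurable fun r s h => lintegral_mono_set (Metric.closedBall_subset_closedBall h)
    have h2 : Measurable fun r => volume (Metric.closedBall p r) :=
      Monotone.measurable fun r s h => measure_mono (Metric.closedBall_subset_closedBall h)
    exact ((h1.div h2).comp (measurable_const_mul (ε n))).aemeasurable
  refine tendsto_of_tendsto_of_tendsto_of_le_of_le tendsto_const_nhds ?_ (fun n => bot_le) hbound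
  rw [← lintegral_zero (μ := volume.restrict (Set.Ioi (0 : ℝ)))]
  refine tendsto_lintegral_of_dominated_convergence'
    (fun r => ENNReal.ofReal (8 * M) * ENNReal.ofReal (1 + r ^ 2)⁻¹)
    (fun n => (Measurable.aemeasurable (by fun_prop)).mul
      ((Measurable.aemeasurable (by fun_prop)).mul (hAm n))) (fun n => ?_) ?_ ?_
  · rw [EventuallyLE, ae_restrict_iff' measurableSet_Ioi]
    refine Eventually.of_forall fun r hr => ?_
    have hr' : 0 < r := hr
    refine (mul_le_mul_right (mul_le_mul_right (hAle _) _) _).trans ?_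
    rw [← ENNReal.ofReal_mul (by positivity), ← ENNReal.ofReal_mul (by positivity),
      ← ENNReal.ofReal_mul (by linarith [(norm_nonneg _).trans hMp])]
    refine ENNReal.ofReal_le_ofReal ?_
    have hM0 : 0 ≤ M := (norm_nonneg _).trans hMp
    have : 2 * r / (1 + r ^ 2) ^ 2 * (2 * r * (2 * M)) =
        8 * M * (1 + r ^ 2)⁻¹ * (r ^ 2 / (1 + r ^ 2)) := by
      field_simp; ring
    rw [this]
    have h1 : r ^ 2 / (1 + r ^ 2) ≤ 1 := by rw [div_le_one (by positivity)]; linarith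
    exact mul_le_of_le_one_right (by positivity) h1
  · rw [lintegral_const_mul _ (by fun_prop)]
    refine ENNReal.mul_ne_top ENNReal.ofReal_ne_top ?_
    exact (integrable_inv_one_add_sq.integrableOn.lintegral_lt_top).ne
  · rw [ae_restrict_iff' measurableSet_Ioi]
    refine Eventually.of_forall fun r hr => ?_
    have hr' : 0 < r := hr
    have hlim : Tendsto (fun n => ε n * r) atTop (𝓝[>] 0) := by
      rw [tendsto_nhdsWithin_iff]
      refine ⟨by simpa using h0.mul_const r, Eventually.of_forall fun n => mul_pos (hε n) hr'⟩
    have h2 := hp.comp hlim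
    have h3 := ENNReal.Tendsto.const_mul (a := ENNReal.ofReal (2 * r / (1 + r ^ 2) ^ 2) *
      ENNReal.ofReal (2 * r)) h2 (Or.inr (ENNReal.mul_ne_top ENNReal.ofReal_ne_top ENNReal.ofReal_ne_top))
    rw [mul_zero] at h3
    refine h3.congr fun n => ?_
    rw [mul_assoc]
    rfl

end Poisson

/-! ### Energy of a function from its Cauchy forms -/

section CauchyForms
open Filter Topology

theorem energy_congr {f g : ℝ → ℂ} (h : f =ᵐ[volume] g) : energy f = energy g := by
  refine lintegral_congr_ae ?_
  filter_upwards [h] with q hq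
  refine lintegral_congr_ae ?_
  filter_upwards [h] with p hp
  rw [hp, hq]

theorem measurable_energy_integrand {f : ℝ → ℂ} (hf : Measurable f) :
    Measurable fun z : ℝ × ℝ => ‖f z.2 - f z.1‖ₑ ^ 2 / ‖z.2 - z.1‖ₑ ^ 2 :=
  (((hf.comp measurable_snd).sub (hf.comp measurable_fst)).enorm.pow_const 2).div
    ((measurable_snd.sub measurable_fst).enorm.pow_const 2)

/-- Fatou's lemma for the energy. -/
theorem energy_le_of_tendsto {g : ℕ → ℝ → ℂ} {f : ℝ → ℂ} (hg : ∀ n, Measurable (g n))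
    (h : ∀ᵐ p, Tendsto (fun n => g n p) atTop (𝓝 (f p))) {C : ℝ≥0∞}
    (hC : ∀ n, energy (g n) ≤ C) : energy f ≤ C := by
  have hm := fun n => measurable_energy_integrand (hg n)
  calc energy f
      ≤ ∫⁻ q, ∫⁻ p, liminf (fun n => ‖g n p - g n q‖ₑ ^ 2 / ‖p - q‖ₑ ^ 2) atTop := by
        refine lintegral_mono_ae ?_
        filter_upwards [h] with q hq
        refine lintegral_mono_ae ?_
        filter_upwards [h] with p hp
        refine le_of_eq (Tendsto.liminf_eq ?_).symm
        rcases eq_or_ne p q with rfl | hpq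
        · simp
        · refine ENNReal.Tendsto.div_const ?_ (Or.inr ?_)
          · exact ((ENNReal.continuous_pow 2).tendsto _).comp (hp.sub hq).enorm
          · simpa [sub_eq_zero] using hpq
    _ ≤ ∫⁻ q, liminf (fun n => ∫⁻ p, ‖g n p - g n q‖ₑ ^ 2 / ‖p - q‖ₑ ^ 2) atTop :=
        lintegral_mono fun q => lintegral_liminf_le fun n => (hm n).comp measurable_prodMk_left
    _ ≤ liminf (fun n => energy (g n)) atTop :=
        lintegral_liminf_le fun n => (hm n).lintegral_prod_right'
    _ ≤ C := by
        refine (liminf_le_liminf (Eventually.of_forall hC)).trans ?_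
        simp

theorem lintegral_lintegral_const_mul {G : ℝ × ℝ → ℝ≥0∞} (hG : Measurable G) (c : ℝ≥0∞) :
    ∫⁻ q, ∫⁻ p, c * G (q, p) = c * ∫⁻ q, ∫⁻ p, G (q, p) := by
  rw [← lintegral_const_mul _ hG.lintegral_prod_right']
  refine lintegral_congr fun q => ?_
  exact lintegral_const_mul c (f := fun p => G (q, p)) (hG.comp measurable_prodMk_left)

theorem lintegral_lintegral_add {G H : ℝ × ℝ → ℝ≥0∞} (hG : Measurable G) :
    ∫⁻ q, ∫⁻ p, (G (q, p) + H (q, p)) =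
      (∫⁻ q, ∫⁻ p, G (q, p)) + ∫⁻ q, ∫⁻ p, H (q, p) := by
  rw [← lintegral_add_left hG.lintegral_prod_right']
  refine lintegral_congr fun q => ?_
  exact lintegral_add_left (f := fun p => G (q, p)) (hG.comp measurable_prodMk_left) _

theorem energy_const_mul (c : ℂ) {f : ℝ → ℂ} (hf : Measurable f) :
    energy (fun p => c * f p) = ‖c‖ₑ ^ 2 * energy f := by
  refine Eq.trans ?_ (lintegral_lintegral_const_mul (measurable_energy_integrand hf) _)
  refine lintegral_congr fun q => lintegral_congr fun p => ?_
  simp only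
  rw [← mul_sub, enorm_mul, mul_pow, mul_div_assoc]

/-- The bilinear Cauchy form `∫ f(s) / ((ε + iσ(s - p)) (ε + iσ(s - q))) ds`, for a sign `σ`. -/
def cauchyForm (f : ℝ → ℂ) (ε σ p q : ℝ) : ℂ :=
  ∫ s : ℝ, f s * ((ε + σ * Complex.I * (s - p))⁻¹ * (ε + σ * Complex.I * (s - q))⁻¹)

/-- The Poisson mean `∫ f(p + εt) / (1 + t²) dt`, whose total weight is `π`. -/
def poissonMean (f : ℝ → ℂ) (ε p : ℝ) : ℂ := ∫ t : ℝ, ((1 + t ^ 2)⁻¹ : ℝ) * f (p + ε * t)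

variable {f : ℝ → ℂ} {M : ℝ}

theorem poissonMean_eq {ε : ℝ} (hε : 0 < ε) (p : ℝ) :
    poissonMean f ε p = ∫ s : ℝ, f s * (ε / (ε ^ 2 + (s - p) ^ 2) : ℝ) := by
  have h := Measure.integral_comp_mul_left
    (fun x : ℝ => f (p + x) * (ε / (ε ^ 2 + (p + x - p) ^ 2) : ℝ)) ε
  rw [integral_add_left_eq_self (fun s : ℝ => f s * (ε / (ε ^ 2 + (s - p) ^ 2) : ℝ)) p,
    abs_of_pos (inv_pos.2 hε), eq_inv_smul_iff₀ hε.ne', ← integral_smul] at h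
  rw [← h, poissonMean]
  refine integral_congr_ae (Eventually.of_forall fun t => ?_)
  have e : (1 + t ^ 2)⁻¹ = ε * (ε / (ε ^ 2 + (p + ε * t - p) ^ 2)) := by
    field_simp
    ring
  simp only [e, Complex.real_smul, Complex.ofReal_mul]
  ring

theorem integrable_poisson_mul (hf : Measurable f) (hM : ∀ x, ‖f x‖ ≤ M) (ε p : ℝ) :
    Integrable fun t : ℝ => (((1 + t ^ 2)⁻¹ : ℝ) : ℂ) * f (p + ε * t) :=
  integrable_inv_one_add_sq.ofReal.mul_bdd (c := M)
    (hf.comp (by fun_prop)).aestronglyMeasurable (Eventually.of_forall fun t => hM _)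

theorem integrable_inv_sq_add_sq {ε : ℝ} (hε : 0 < ε) (p : ℝ) :
    Integrable fun s : ℝ => (ε ^ 2 + (s - p) ^ 2)⁻¹ := by
  have h := ((integrable_inv_one_add_sq.comp_mul_left' (inv_ne_zero hε.ne')).comp_sub_right
    p).const_mul (ε ^ 2)⁻¹
  refine h.congr (Eventually.of_forall fun s => ?_)
  simp only
  rw [← mul_inv]
  congr 1
  field_simp

theorem normSq_linear (ε σ x : ℝ) (hσ : σ ^ 2 = 1) :
    ‖(ε + σ * Complex.I * x : ℂ)‖ ^ 2 = ε ^ 2 + x ^ 2 := by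
  rw [← Complex.normSq_eq_norm_sq, Complex.normSq_apply]
  simp
  linear_combination x ^ 2 * hσ

theorem linear_ne_zero {ε : ℝ} (hε : 0 < ε) (σ x : ℝ) : (ε + σ * Complex.I * x : ℂ) ≠ 0 :=
  fun h => by
    have := congrArg Complex.re h
    simp [hε.ne'] at this

theorem memLp_cauchy {ε : ℝ} (hε : 0 < ε) {σ : ℝ} (hσ : σ ^ 2 = 1) (p : ℝ) :
    MemLp (fun s : ℝ => (ε + σ * Complex.I * (s - p) : ℂ)⁻¹) 2 := by
  rw [memLp_two_iff_integrable_sq_norm]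
  · refine (integrable_inv_sq_add_sq hε p).congr (Eventually.of_forall fun s => ?_)
    have := normSq_linear ε σ (s - p) hσ
    push_cast at this
    simp only [norm_inv, inv_pow, this]
  · exact Measurable.aestronglyMeasurable (by fun_prop)

theorem integrable_cauchyForm (hf : Measurable f) (hM : ∀ x, ‖f x‖ ≤ M) {ε : ℝ} (hε : 0 < ε)
    {σ : ℝ} (hσ : σ ^ 2 = 1) (p q : ℝ) :
    Integrable fun s : ℝ =>
      f s * ((ε + σ * Complex.I * (s - p) : ℂ)⁻¹ * (ε + σ * Complex.I * (s - q) : ℂ)⁻¹) :=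
  (MemLp.integrable_mul (memLp_cauchy hε hσ p) (memLp_cauchy hε hσ q)).bdd_mul (c := M)
    hf.aestronglyMeasurable (Eventually.of_forall hM)

theorem measurable_cauchyForm (hf : Measurable f) (ε σ : ℝ) :
    Measurable fun z : ℝ × ℝ => cauchyForm f ε σ z.2 z.1 := by
  have h : StronglyMeasurable fun w : (ℝ × ℝ) × ℝ => f w.2 *
      ((ε + σ * Complex.I * (w.2 - w.1.2) : ℂ)⁻¹ * (ε + σ * Complex.I * (w.2 - w.1.1) : ℂ)⁻¹) :=
    Measurable.stronglyMeasurable (by fun_prop)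
  exact h.integral_prod_right'.measurable

theorem measurable_poissonMean (hf : Measurable f) (ε : ℝ) : Measurable (poissonMean f ε) := by
  have h : StronglyMeasurable fun w : ℝ × ℝ => (((1 + w.2 ^ 2)⁻¹ : ℝ) : ℂ) * f (w.1 + ε * w.2) :=
    Measurable.stronglyMeasurable (by fun_prop)
  exact h.integral_prod_right'.measurable

/-- Partial fractions: the Poisson kernel is the sum of the two Cauchy kernels, and differences of
Cauchy kernels are multiples of their products. -/
theorem poissonMean_sub (hf : Measurable f) (hM : ∀ x, ‖f x‖ ≤ M) {ε : ℝ} (hε : 0 < ε) (p q : ℝ) :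
    2 * (poissonMean f ε p - poissonMean f ε q) =
      Complex.I * (p - q) * (cauchyForm f ε 1 p q - cauchyForm f ε (-1) p q) := by
  have hi : ∀ p, Integrable fun s : ℝ => f s * ((ε / (ε ^ 2 + (s - p) ^ 2) : ℝ) : ℂ) := fun p =>
    (((integrable_inv_sq_add_sq hε p).const_mul ε).ofReal).bdd_mul (c := M)
      hf.aestronglyMeasurable (Eventually.of_forall hM)
  rw [poissonMean_eq hε, poissonMean_eq hε, cauchyForm, cauchyForm,
    ← integral_sub (hi p) (hi q), ← integral_sub (integrable_cauchyForm hf hM hε (by norm_num) p q)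
      (integrable_cauchyForm hf hM hε (by norm_num) p q), ← integral_const_mul,
    ← integral_const_mul]
  refine integral_congr_ae (Eventually.of_forall fun s => ?_)
  have h1 := linear_ne_zero hε 1 (s - p)
  have h2 := linear_ne_zero hε 1 (s - q)
  have h3 := linear_ne_zero hε (-1) (s - p)
  have h4 := linear_ne_zero hε (-1) (s - q)
  have e : ∀ x : ℝ, ((ε / (ε ^ 2 + x ^ 2) : ℝ) : ℂ) =
      ε * ((ε + (1 : ℝ) * Complex.I * x)⁻¹ * (ε + (-1 : ℝ) * Complex.I * x)⁻¹) := by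
    intro x
    rw [← mul_inv, div_eq_mul_inv]
    push_cast
    congr 2
    linear_combination (x : ℂ) ^ 2 * Complex.I_sq
  have k1 : ∀ {x y c : ℂ}, x ≠ 0 → y ≠ 0 → x + y = c → c * (x⁻¹ * y⁻¹) = x⁻¹ + y⁻¹ := by
    rintro x y _ hx hy rfl
    field_simp
    ring
  have k2 : ∀ {x y c : ℂ}, x ≠ 0 → y ≠ 0 → y - x = c → c * (x⁻¹ * y⁻¹) = x⁻¹ - y⁻¹ := by
    rintro x y _ hx hy rfl
    field_simp
  have e1 := k1 (c := 2 * ε) h1 h3 (by push_cast; ring)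
  have e2 := k1 (c := 2 * ε) h2 h4 (by push_cast; ring)
  have e3 := k2 (c := Complex.I * (p - q)) h1 h2 (by push_cast; ring)
  have e4 := k2 (c := -(Complex.I * (p - q))) h3 h4 (by push_cast; ring)
  simp only [e]
  push_cast at e1 e2 e3 e4 ⊢
  linear_combination f s * (e1 - e2 - e3 - e4)

theorem enorm_sub_sq_le_two_mul (a b : ℂ) : ‖a - b‖ₑ ^ 2 ≤ 2 * (‖a‖ₑ ^ 2 + ‖b‖ₑ ^ 2) := by
  have h := norm_sub_le a b
  have h' : ‖a - b‖ ^ 2 ≤ 2 * (‖a‖ ^ 2 + ‖b‖ ^ 2) := by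
    nlinarith [norm_nonneg (a - b), norm_nonneg a, norm_nonneg b, sq_nonneg (‖a‖ - ‖b‖)]
  have h2 := ENNReal.ofReal_le_ofReal h'
  rw [ENNReal.ofReal_mul (by norm_num), ENNReal.ofReal_add (by positivity) (by positivity),
    ENNReal.ofReal_pow (norm_nonneg _), ENNReal.ofReal_pow (norm_nonneg _),
    ENNReal.ofReal_pow (norm_nonneg _)] at h2
  simpa [ofReal_norm] using h2

/-- The energy of the Poisson means is bounded uniformly in `ε`, as the factor `p - q` of
`poissonMean_sub` cancels the weight of the energy. -/
theorem energy_poissonMean_le (hf : Measurable f) (hM : ∀ x, ‖f x‖ ≤ M) {ε : ℝ} (hε : 0 < ε)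
    {C : ℝ≥0∞} (hC : ∀ σ : ℝ, σ ^ 2 = 1 → ∫⁻ q, ∫⁻ p, ‖cauchyForm f ε σ p q‖ₑ ^ 2 ≤ C) :
    energy (poissonMean f ε) ≤ 4 * C := by
  have hm := fun σ => (measurable_cauchyForm hf ε σ).enorm.pow_const 2
  calc energy (poissonMean f ε)
      ≤ ∫⁻ q, ∫⁻ p, 2 * (‖cauchyForm f ε 1 p q‖ₑ ^ 2 + ‖cauchyForm f ε (-1) p q‖ₑ ^ 2) := by
        refine lintegral_mono fun q => lintegral_mono fun p => ?_
        refine le_trans (ENNReal.div_le_of_le_mul ?_) (enorm_sub_sq_le_two_mul _ _)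
        rw [← mul_pow]
        gcongr
        have h := congrArg norm (poissonMean_sub hf hM hε p q)
        rw [norm_mul, norm_mul, norm_mul, Complex.norm_I, ← Complex.ofReal_sub, Complex.norm_real,
          Complex.norm_ofNat] at h
        rw [← ofReal_norm, ← ofReal_norm, ← ofReal_norm, ← ENNReal.ofReal_mul (norm_nonneg _)]
        refine ENNReal.ofReal_le_ofReal ?_
        linarith [norm_nonneg (poissonMean f ε p - poissonMean f ε q)]
    _ = 2 * (∫⁻ q, ∫⁻ p, ‖cauchyForm f ε 1 p q‖ₑ ^ 2) +
        2 * ∫⁻ q, ∫⁻ p, ‖cauchyForm f ε (-1) p q‖ₑ ^ 2 := by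
        rw [← mul_add]
        refine (lintegral_lintegral_const_mul ((hm 1).add (hm (-1))) 2).trans ?_
        exact congrArg _ (lintegral_lintegral_add
          (H := fun z => ‖cauchyForm f ε (-1) z.2 z.1‖ₑ ^ 2) (hm 1))
    _ ≤ 2 * C + 2 * C := by gcongr <;> exact hC _ (by norm_num)
    _ = 4 * C := by ring

/-- The Poisson means converge to `π f` almost everywhere. -/
theorem tendsto_poissonMean (hf : Measurable f) (hM : ∀ x, ‖f x‖ ≤ M)
    {ε : ℕ → ℝ} (hε : ∀ n, 0 < ε n) (h0 : Tendsto ε atTop (𝓝 0)) :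
    ∀ᵐ p, Tendsto (fun n => poissonMean f (ε n) p) atTop (𝓝 (Real.pi * f p)) := by
  filter_upwards [tendsto_poisson_error hf (Eventually.of_forall hM) hε h0] with p hp
  rw [tendsto_iff_edist_tendsto_0]
  refine tendsto_of_tendsto_of_tendsto_of_le_of_le tendsto_const_nhds hp (fun n => bot_le)
    fun n => ?_
  have hi : Integrable fun t : ℝ => (((1 + t ^ 2)⁻¹ : ℝ) : ℂ) := integrable_inv_one_add_sq.ofReal
  have e : (Real.pi : ℂ) * f p = ∫ t : ℝ, ((1 + t ^ 2)⁻¹ : ℝ) * f p := by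
    rw [integral_mul_const, integral_complex_ofReal, integral_univ_inv_one_add_sq]
  simp only
  rw [edist_eq_enorm_sub, e, poissonMean, ← integral_sub (integrable_poisson_mul hf hM (ε n) p)
    (hi.mul_const _)]
  refine (enorm_integral_le_lintegral_enorm _).trans (le_of_eq (lintegral_congr fun t => ?_))
  rw [← mul_sub, enorm_mul]
  congr 1
  rw [← ofReal_norm, Complex.norm_real, Real.norm_of_nonneg (by positivity)]

/-- The energy is controlled by the square integrals of the Cauchy forms. -/
theorem energy_le_of_cauchyForm (hf : Measurable f) (hM : ∀ x, ‖f x‖ ≤ M) {C : ℝ≥0∞}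
    (hC : ∀ ε > 0, ∀ σ : ℝ, σ ^ 2 = 1 → ∫⁻ q, ∫⁻ p, ‖cauchyForm f ε σ p q‖ₑ ^ 2 ≤ C) :
    energy f ≤ 4 * C := by
  have hε : ∀ n : ℕ, (0 : ℝ) < 1 / ((n : ℝ) + 1) := fun n => by positivity
  have h := energy_le_of_tendsto (fun n => measurable_poissonMean hf _)
    (tendsto_poissonMean hf hM hε tendsto_one_div_add_atTop_nhds_zero_nat)
    fun n => energy_poissonMean_le hf hM (hε n) (hC _ (hε n))
  -- The limit of the Poisson means is `π f`, and the factor `π²` exceeds one.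
  rw [energy_const_mul _ hf] at h
  refine le_trans (le_mul_of_one_le_left bot_le (one_le_pow₀ ?_)) h
  rw [← ofReal_norm, Complex.norm_real, Real.norm_of_nonneg Real.pi_pos.le, ENNReal.one_le_ofReal]
  linarith [Real.pi_gt_three]

end CauchyForms

/-! ### Hilbert–Schmidt implies finite energy -/

section HankelToEnergy
open Filter Topology
variable {N : ℕ}

/-- The `(i, j)` entry of a matrix, as a continuous linear functional. -/
def entryCLM (i j : Fin N) : Matrix (Fin N) (Fin N) ℂ →L[ℂ] ℂ :=
  LinearMap.toContinuousLinearMap (Matrix.entryLinearMap ℂ ℂ i j)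

theorem memLp_symbol_rescale (Φ : MatrixSymbol N) (i j : Fin N) :
    MemLp (fun s => Φ (2 * Real.pi * s) i j) ∞ :=
  (entryCLM i j).comp_memLp' (memLp_rescale Φ)

/-- An essentially bounded measurable function agrees almost everywhere with a bounded one. -/
theorem exists_bounded_representative {f : ℝ → ℂ} (hm : Measurable f) (hf : MemLp f ∞) :
    ∃ (g : ℝ → ℂ) (M : ℝ), Measurable g ∧ (∀ x, ‖g x‖ ≤ M) ∧ f =ᵐ[volume] g := by
  set M := (eLpNorm f ∞ volume).toReal with hM
  have hb : ∀ᵐ x, ‖f x‖ ≤ M := by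
    have h := ae_le_eLpNormEssSup (f := f) (μ := volume)
    filter_upwards [h] with x hx
    rw [← eLpNorm_exponent_top] at hx
    have := ENNReal.toReal_mono hf.2.ne hx
    simpa [hM] using this
  have hs : MeasurableSet {x | ‖f x‖ ≤ M} := measurableSet_le (by fun_prop) measurable_const
  refine ⟨{x | ‖f x‖ ≤ M}.indicator f, M, hm.indicator hs, fun x => ?_, ?_⟩
  · by_cases hx : ‖f x‖ ≤ M
    · rw [Set.indicator_of_mem (by exact hx)]; exact hx
    · rw [Set.indicator_of_notMem (by exact hx), norm_zero]; exact ENNReal.toReal_nonneg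
  · filter_upwards [hb] with x hx
    rw [Set.indicator_of_mem (by exact hx)]

theorem cauchyForm_congr {f g : ℝ → ℂ} (h : f =ᵐ[volume] g) (ε σ p q : ℝ) :
    cauchyForm f ε σ p q = cauchyForm g ε σ p q := by
  refine integral_congr_ae ?_
  filter_upwards [h] with s hs
  rw [hs]

theorem cauchyForm_star (f : ℝ → ℂ) (ε σ p q : ℝ) :
    cauchyForm (fun s => star (f s)) ε (-σ) p q = star (cauchyForm f ε σ p q) := by
  rw [cauchyForm, cauchyForm, Complex.star_def, ← integral_conj]
  refine integral_congr_ae (Eventually.of_forall fun s => ?_)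
  simp

/-- The matrix elements of the Hankel operator between the exponential vectors are Cauchy forms. -/
theorem inner_leftVec_hankel_rightVec (Φ : MatrixSymbol N) {ε : ℝ} (hε : 0 < ε) (i j : Fin N)
    (p q : ℝ) :
    inner ℂ (leftVec hε (EuclideanSpace.single i 1) p)
        (hankel Φ (rightVec hε (EuclideanSpace.single j 1) q)) =
      (4 * Real.pi ^ 2 : ℂ)⁻¹ * cauchyForm (fun s => Φ (2 * Real.pi * s) i j) ε 1 p q := by
  set w := leftVec hε (EuclideanSpace.single i 1 : EuclideanSpace ℂ (Fin N)) p with hw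
  set v := rightVec hε (EuclideanSpace.single j 1 : EuclideanSpace ℂ (Fin N)) q with hv
  have h1 : inner ℂ w (hankel Φ v) = inner ℂ (w : L2Line N) (fourierMultiplier Φ v) :=
    Submodule.inner_orthogonalProjectionOnto_eq_of_mem_left w _
  rw [h1, ← Lp.inner_fourier_eq, L2.inner_def, cauchyForm, ← integral_const_mul]
  refine integral_congr_ae ?_
  filter_upwards [fourier_leftVec hε (EuclideanSpace.single i 1) p,
    fourier_fourierMultiplier Φ v, fourier_rightVec hε (EuclideanSpace.single j 1) q]
    with s a1 a2 a3
  rw [a2, a1, a3, inner_smul_left, EuclideanSpace.inner_single_left]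
  have h2 : starRingEnd ℂ 2 = 2 := map_ofNat _ 2
  simp [Matrix.mulVec_smul, h2]
  ring

/-- If the Hankel operator of a self-adjoint symbol is Hilbert–Schmidt, the entries of the symbol
have finite energy. -/
theorem energy_lt_top_of_isHilbertSchmidt (Φ : MatrixSymbol N)
    (hs : ∀ᵐ p, IsSelfAdjoint (Φ p)) (h : IsHilbertSchmidt (hankel Φ)) (i j : Fin N) :
    energy (fun s => Φ (2 * Real.pi * s) i j) < ∞ := by
  obtain ⟨u, c, -⟩ := exists_hilbertBasis ℂ (halfLine N)ᗮ
  have hS := (isHilbertSchmidt_iff c (hankel Φ)).1 h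
  set S := ∑' k, ‖ContinuousLinearMap.adjoint (hankel Φ) (c k)‖ₑ ^ 2
  set C := ‖(4 * Real.pi ^ 2 : ℂ)‖ₑ ^ 2 * S with hC
  have hpi : (4 * Real.pi ^ 2 : ℂ) ≠ 0 := by simp [Real.pi_ne_zero]
  have hb : ∀ i j, ∀ ε > 0,
      ∫⁻ q, ∫⁻ p, ‖cauchyForm (fun s => Φ (2 * Real.pi * s) i j) ε 1 p q‖ₑ ^ 2 ≤ C := by
    intro i j ε hε
    have e : ∀ p q, ‖cauchyForm (fun s => Φ (2 * Real.pi * s) i j) ε 1 p q‖ₑ ^ 2 =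
        ‖(4 * Real.pi ^ 2 : ℂ)‖ₑ ^ 2 * ‖inner ℂ (leftVec hε (EuclideanSpace.single i 1) p)
          (hankel Φ (rightVec hε (EuclideanSpace.single j 1) q))‖ₑ ^ 2 := by
      intro p q
      rw [inner_leftVec_hankel_rightVec, ← mul_pow, ← enorm_mul, mul_inv_cancel_left₀ hpi]
    simp_rw [e]
    calc _ ≤ ∫⁻ q, ‖(4 * Real.pi ^ 2 : ℂ)‖ₑ ^ 2 *
            ‖hankel Φ (rightVec hε (EuclideanSpace.single j 1) q)‖ₑ ^ 2 := by
          refine lintegral_mono fun q => ?_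
          rw [lintegral_const_mul' _ _ (ENNReal.pow_ne_top enorm_ne_top)]
          exact mul_le_mul_right (lintegral_inner_leftVec_le hε i _) _
      _ ≤ C := by
          rw [lintegral_const_mul' _ _ (ENNReal.pow_ne_top enorm_ne_top), hC]
          refine mul_le_mul_right ?_ _
          exact lintegral_enorm_sq_le_of_bessel c (hankel Φ) h _
            (fun x => (measurable_inner_rightVec hε j x).aemeasurable)
            (lintegral_inner_rightVec_le hε j)
  -- Self-adjointness turns the Cauchy form with `σ = -1` of one entry into the one with `σ = 1` of the
  -- transposed entry.
  have hadj : (fun s => Φ (2 * Real.pi * s) i j) =ᵐ[volume]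
      fun s => star (Φ (2 * Real.pi * s) j i) := by
    have hq : Measure.QuasiMeasurePreserving (fun s : ℝ => 2 * Real.pi * s) volume volume := by
      refine ⟨by fun_prop, ?_⟩
      rw [Real.map_volume_mul_left (by positivity)]
      exact Measure.smul_absolutelyContinuous
    filter_upwards [hq.ae hs] with s h
    have := congrFun (congrFun h.star_eq i) j
    rw [← this]
    simp [Matrix.star_apply]
  obtain ⟨g, M, hg, hM, hfg⟩ := exists_bounded_representative (measurable_symbol_rescale Φ i j)
    (memLp_symbol_rescale Φ i j)
  rw [energy_congr hfg]
  refine lt_of_le_of_lt (energy_le_of_cauchyForm hg hM (C := C) fun ε hε σ hσ => ?_) ?_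
  · rcases sq_eq_one_iff.1 hσ with rfl | rfl
    · simp_rw [← cauchyForm_congr hfg]
      exact hb i j ε hε
    · simp_rw [← cauchyForm_congr hfg, cauchyForm_congr hadj, cauchyForm_star]
      refine le_of_eq_of_le ?_ (hb j i ε hε)
      simp
  · refine ENNReal.mul_lt_top (by simp) (ENNReal.mul_lt_top (ENNReal.pow_lt_top enorm_lt_top) hS)

end HankelToEnergy

/-! ### Dilations -/

section Dilations
open Filter Topology

theorem energy_comp_mul_left (f : ℝ → ℂ) {a : ℝ} (ha : a ≠ 0) :
    energy (fun s => f (a * s)) = energy f := by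
  have ha' : ‖a‖ₑ ≠ 0 := by simpa using ha
  have hab : ENNReal.ofReal |a⁻¹| = ‖a‖ₑ⁻¹ := by
    rw [← enorm_inv ha, ← ofReal_norm, Real.norm_eq_abs]
  have e : ∀ p q, ‖f (a * p) - f (a * q)‖ₑ ^ 2 / ‖p - q‖ₑ ^ 2 =
      ‖a‖ₑ ^ 2 * (‖f (a * p) - f (a * q)‖ₑ ^ 2 / ‖a * p - a * q‖ₑ ^ 2) := by
    intro p q
    rw [← mul_sub, enorm_mul, mul_pow, div_eq_mul_inv, div_eq_mul_inv,
      ENNReal.mul_inv (Or.inl (pow_ne_zero 2 ha')) (Or.inl (ENNReal.pow_ne_top enorm_ne_top)),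
      mul_left_comm, ← mul_assoc (‖a‖ₑ ^ 2), ENNReal.mul_inv_cancel (pow_ne_zero 2 ha')
        (ENNReal.pow_ne_top enorm_ne_top), one_mul]
  have hc : ‖a‖ₑ ^ 2 ≠ ∞ := ENNReal.pow_ne_top enorm_ne_top
  simp only [energy, e]
  simp_rw [lintegral_const_mul' _ _ hc]
  rw [lintegral_congr fun q => lintegral_comp_mul_left ha
      (fun p => ‖f p - f (a * q)‖ₑ ^ 2 / ‖p - a * q‖ₑ ^ 2),
    lintegral_const_mul' _ _ ENNReal.ofReal_ne_top,
    lintegral_comp_mul_left ha (fun q => ∫⁻ p, ‖f p - f q‖ₑ ^ 2 / ‖p - q‖ₑ ^ 2), hab,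
    ← mul_assoc, ← mul_assoc, pow_two, mul_assoc ‖a‖ₑ,
    ENNReal.mul_inv_cancel ha' enorm_ne_top, mul_one, ENNReal.mul_inv_cancel ha' enorm_ne_top,
    one_mul]

theorem enorm_sq_le_energy_density {x y z : ℝ} (f : ℝ → ℂ) (hz : z ≠ 0) (h : |x - y| ≤ |z|) :
    ‖f x - f y‖ₑ ^ 2 / ‖z‖ₑ ≤ ‖z‖ₑ * (‖f y - f x‖ₑ ^ 2 / ‖y - x‖ₑ ^ 2) := by
  rcases eq_or_ne x y with rfl | hxy
  · simp
  have hz' : ‖z‖ₑ ≠ 0 := by simpa using hz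
  rw [enorm_sub_rev (f x), div_eq_mul_inv, div_eq_mul_inv, mul_left_comm]
  refine mul_le_mul_right ?_ _
  have h1 : ‖y - x‖ₑ ≤ ‖z‖ₑ := by
    rw [enorm_sub_rev, enorm_le_iff_norm_le]; exact h
  calc ‖z‖ₑ⁻¹ = ‖z‖ₑ * (‖z‖ₑ ^ 2)⁻¹ := by
        rw [pow_two, ENNReal.mul_inv (Or.inl hz') (Or.inl enorm_ne_top), ← mul_assoc,
          ENNReal.mul_inv_cancel hz' enorm_ne_top, one_mul]
    _ ≤ _ := by gcongr

theorem lintegral_dilation_le (f : ℝ → ℂ) {x z : ℝ} (hz : z ≠ 0)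
    (h : ∀ s ∈ Set.Ioo (1 : ℝ) 2, |x - z * s| ≤ |z|) :
    ∫⁻ s in Set.Ioo (1 : ℝ) 2, ‖f x - f (z * s)‖ₑ ^ 2 / ‖z‖ₑ ≤
      ∫⁻ y, ‖f y - f x‖ₑ ^ 2 / ‖y - x‖ₑ ^ 2 := by
  calc _ ≤ ∫⁻ s in Set.Ioo (1 : ℝ) 2,
          ‖z‖ₑ * (‖f (z * s) - f x‖ₑ ^ 2 / ‖z * s - x‖ₑ ^ 2) :=
        setLIntegral_mono' measurableSet_Ioo fun s hs => enorm_sq_le_energy_density f hz (h s hs)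
    _ ≤ ∫⁻ s, ‖z‖ₑ * (‖f (z * s) - f x‖ₑ ^ 2 / ‖z * s - x‖ₑ ^ 2) := setLIntegral_le_lintegral _ _
    _ = _ := by
        rw [lintegral_const_mul' _ _ enorm_ne_top,
          lintegral_comp_mul_left hz (fun y => ‖f y - f x‖ₑ ^ 2 / ‖y - x‖ₑ ^ 2), ← mul_assoc]
        have hz' : ‖z‖ₑ ≠ 0 := by simpa using hz
        rw [← Real.norm_eq_abs, ofReal_norm, enorm_inv hz, ENNReal.mul_inv_cancel hz' enorm_ne_top,
          one_mul]

/-- Inserting the intermediate points `q = sp`, `1 < s < 2`, bounds the dilation differences by the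
energy. -/
theorem lintegral_dilation_two_le {f : ℝ → ℂ} (hf : Measurable f) :
    ∫⁻ p, ‖f (2 * p) - f p‖ₑ ^ 2 / ‖p‖ₑ ≤ 4 * energy f := by
  have hI : Measurable fun x => ∫⁻ y, ‖f y - f x‖ₑ ^ 2 / ‖y - x‖ₑ ^ 2 :=
    (measurable_energy_integrand hf).lintegral_prod_right'
  have key : ∀ p : ℝ, p ≠ 0 → ‖f (2 * p) - f p‖ₑ ^ 2 / ‖p‖ₑ ≤
      2 * ((∫⁻ y, ‖f y - f (2 * p)‖ₑ ^ 2 / ‖y - 2 * p‖ₑ ^ 2) +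
        ∫⁻ y, ‖f y - f p‖ₑ ^ 2 / ‖y - p‖ₑ ^ 2) := by
    intro p hp
    have hm : Measurable fun s => ‖f (2 * p) - f (p * s)‖ₑ ^ 2 / ‖p‖ₑ := by fun_prop
    calc ‖f (2 * p) - f p‖ₑ ^ 2 / ‖p‖ₑ
        = ∫⁻ s in Set.Ioo (1 : ℝ) 2, ‖f (2 * p) - f p‖ₑ ^ 2 / ‖p‖ₑ := by
          rw [setLIntegral_const, Real.volume_Ioo]; norm_num
      _ ≤ ∫⁻ s in Set.Ioo (1 : ℝ) 2, 2 * (‖f (2 * p) - f (p * s)‖ₑ ^ 2 / ‖p‖ₑ +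
            ‖f p - f (p * s)‖ₑ ^ 2 / ‖p‖ₑ) := by
          refine lintegral_mono fun s => ?_
          rw [← ENNReal.add_div, ← mul_div_assoc]
          refine ENNReal.div_le_div_right ?_ _
          have := enorm_sub_sq_le_two_mul (f (2 * p) - f (p * s)) (f p - f (p * s))
          rwa [sub_sub_sub_cancel_right] at this
      _ = 2 * ((∫⁻ s in Set.Ioo (1 : ℝ) 2, ‖f (2 * p) - f (p * s)‖ₑ ^ 2 / ‖p‖ₑ) +
            ∫⁻ s in Set.Ioo (1 : ℝ) 2, ‖f p - f (p * s)‖ₑ ^ 2 / ‖p‖ₑ) := by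
          rw [lintegral_const_mul' _ _ (by simp), lintegral_add_left hm]
      _ ≤ _ := by
          refine mul_le_mul_right (add_le_add (lintegral_dilation_le f hp fun s hs => ?_)
            (lintegral_dilation_le f hp fun s hs => ?_)) _
          · have : 2 * p - p * s = p * (2 - s) := by ring
            rw [this, abs_mul, abs_of_pos (by linarith [hs.2] : 0 < 2 - s)]
            nlinarith [abs_nonneg p, hs.1]
          · have : p - p * s = -(p * (s - 1)) := by ring
            rw [this, abs_neg, abs_mul, abs_of_pos (by linarith [hs.1] : 0 < s - 1)]
            nlinarith [abs_nonneg p, hs.2]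
  calc _ ≤ ∫⁻ p, 2 * ((∫⁻ y, ‖f y - f (2 * p)‖ₑ ^ 2 / ‖y - 2 * p‖ₑ ^ 2) +
        ∫⁻ y, ‖f y - f p‖ₑ ^ 2 / ‖y - p‖ₑ ^ 2) := by
        refine lintegral_mono_ae ?_
        filter_upwards [Measure.ae_ne volume (0 : ℝ)] with p hp using key p hp
    _ = 2 * (ENNReal.ofReal |(2 : ℝ)⁻¹| * energy f + energy f) := by
        rw [lintegral_const_mul' _ _ (by simp), lintegral_add_right _ hI,
          lintegral_comp_mul_left two_ne_zero
            (fun x => ∫⁻ y, ‖f y - f x‖ₑ ^ 2 / ‖y - x‖ₑ ^ 2)]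
        rfl
    _ ≤ 2 * (1 * energy f + energy f) := by
        gcongr
        rw [ENNReal.ofReal_le_one]
        norm_num [abs_of_pos]
    _ = _ := by ring

end Dilations
/-! ### Even differentiable functions -/

section EvenDifferentiable
open Filter Topology

/-- The Cauchy–Schwarz inequality, with values in `[0, ∞]`. -/
theorem sq_lintegral_mul_le {α : Type*} [MeasurableSpace α] {μ : Measure α} {a b : α → ℝ≥0∞}
    (ha : AEMeasurable a μ) (hb : AEMeasurable b μ) :
    (∫⁻ x, a x * b x ∂μ) ^ 2 ≤ (∫⁻ x, a x ^ 2 ∂μ) * ∫⁻ x, b x ^ 2 ∂μ := by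
  have h := ENNReal.lintegral_mul_le_Lp_mul_Lq μ Real.HolderConjugate.two_two ha hb
  have h2 := pow_le_pow_left' h 2
  rw [mul_pow, ← ENNReal.rpow_natCast, ← ENNReal.rpow_natCast, ← ENNReal.rpow_natCast,
    ← ENNReal.rpow_mul, ← ENNReal.rpow_mul] at h2
  simpa using h2

/-- The fundamental theorem of calculus along the segment from `s p` to `p`; the right-hand side may
be infinite. -/
theorem enorm_sub_le_lintegral_deriv {f : ℝ → ℂ} (hf : Differentiable ℝ f) {s p : ℝ} (hs : s < 1) :
    ‖f p - f (s * p)‖ₑ ≤ ∫⁻ t in Set.Ioc s 1, ‖p‖ₑ * ‖deriv f (t * p)‖ₑ := by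
  by_cases h : ∫⁻ t in Set.Ioc s 1, ‖p‖ₑ * ‖deriv f (t * p)‖ₑ = ∞
  · rw [h]; exact le_top
  have hd : ∀ t : ℝ, HasDerivAt (fun t => f (t * p)) (p • deriv f (t * p)) t := fun t => by
    have h1 : HasDerivAt (fun t : ℝ => t * p) p t := by
      simpa using (hasDerivAt_id t).mul_const p
    exact (hf (t * p)).hasDerivAt.scomp t h1
  have hi : IntegrableOn (fun t => p • deriv f (t * p)) (Set.Ioc s 1) := by
    refine ⟨Measurable.aestronglyMeasurable ?_, ?_⟩
    · exact ((measurable_deriv f).comp (measurable_mul_const p)).const_smul p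
    · rw [hasFiniteIntegral_iff_enorm]
      simp_rw [enorm_smul]
      exact lt_top_iff_ne_top.2 h
  have hftc := intervalIntegral.integral_eq_sub_of_hasDerivAt (a := s) (b := 1)
    (fun t _ => hd t) ((intervalIntegrable_iff_integrableOn_Ioc_of_le hs.le).2 hi)
  rw [one_mul, intervalIntegral.integral_of_le hs.le] at hftc
  rw [← hftc]
  refine (enorm_integral_le_lintegral_enorm _).trans (le_of_eq ?_)
  simp_rw [enorm_smul]

theorem lintegral_inv_Ioc {s : ℝ} (h0 : 0 < s) (hs : s < 1) :
    ∫⁻ t in Set.Ioc s 1, ENNReal.ofReal t⁻¹ = ENNReal.ofReal (-Real.log s) := by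
  have hi : IntervalIntegrable (fun t : ℝ => t⁻¹) volume s 1 := by
    rw [intervalIntegrable_inv_iff]
    right
    rw [Set.uIcc_of_le hs.le]
    exact fun h => absurd h.1 (not_le.2 h0)
  rw [← ofReal_integral_eq_lintegral_ofReal
    ((intervalIntegrable_iff_integrableOn_Ioc_of_le hs.le).1 hi),
    ← intervalIntegral.integral_of_le hs.le, integral_inv_of_pos h0 one_pos]
  · simp
  · rw [EventuallyLE, ae_restrict_iff' measurableSet_Ioc]
    exact Eventually.of_forall fun t ht => inv_nonneg.2 (h0.trans ht.1).le

/-- The weighted Cauchy–Schwarz inequality along a ray. -/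
theorem enorm_sub_sq_le {f : ℝ → ℂ} (hf : Differentiable ℝ f) {s p : ℝ} (h0 : 0 < s) (hs : s < 1)
    (hp : 0 < p) :
    ‖f p - f (s * p)‖ₑ ^ 2 / ‖p‖ₑ ≤ ENNReal.ofReal (-Real.log s) *
      ∫⁻ t in Set.Ioc s 1, ‖deriv f (t * p)‖ₑ ^ 2 * ENNReal.ofReal (t * p) := by
  have hdm : Measurable fun t => ‖deriv f (t * p)‖ₑ :=
    ((measurable_deriv f).comp (measurable_mul_const p)).enorm
  have hpe : ‖p‖ₑ = ENNReal.ofReal p := by rw [← ofReal_norm, Real.norm_of_nonneg hp.le]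
  refine ENNReal.div_le_of_le_mul ?_
  have h1 : ‖f p - f (s * p)‖ₑ ≤ ∫⁻ t in Set.Ioc s 1,
      ENNReal.ofReal (Real.sqrt t⁻¹) *
        (ENNReal.ofReal (Real.sqrt t * p) * ‖deriv f (t * p)‖ₑ) := by
    refine (enorm_sub_le_lintegral_deriv hf hs).trans (le_of_eq ?_)
    refine setLIntegral_congr_fun measurableSet_Ioc fun t ht => ?_
    have ht0 : 0 < t := h0.trans ht.1
    rw [← mul_assoc, ← ENNReal.ofReal_mul (by positivity), hpe, Real.sqrt_inv, ← mul_assoc,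
      inv_mul_cancel₀ (Real.sqrt_pos.2 ht0).ne', one_mul]
  refine (pow_le_pow_left' h1 2).trans ((sq_lintegral_mul_le (by fun_prop) (by fun_prop)).trans ?_)
  rw [← lintegral_inv_Ioc h0 hs, mul_assoc, mul_comm _ ‖p‖ₑ, ← lintegral_const_mul' _ _ enorm_ne_top]
  refine mul_le_mul' (le_of_eq ?_) (le_of_eq ?_)
  · refine setLIntegral_congr_fun measurableSet_Ioc fun t ht => ?_
    have ht0 : 0 < t := h0.trans ht.1
    rw [← ENNReal.ofReal_pow (by positivity), Real.sq_sqrt (by positivity)]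
  · refine setLIntegral_congr_fun measurableSet_Ioc fun t ht => ?_
    have ht0 : 0 < t := h0.trans ht.1
    rw [mul_pow, ← ENNReal.ofReal_pow (by positivity), mul_pow, Real.sq_sqrt ht0.le, hpe,
      mul_comm (‖deriv f (t * p)‖ₑ ^ 2), ← mul_assoc, ← ENNReal.ofReal_mul hp.le]
    congr 2
    ring

/-- The energy density of dilations by a factor `s`, in terms of the derivative. -/
theorem lintegral_dilation_le_deriv {f : ℝ → ℂ} (hf : Differentiable ℝ f) {s : ℝ} (h0 : 0 < s)
    (hs : s < 1) :
    ∫⁻ p in Set.Ioi (0 : ℝ), ‖f p - f (s * p)‖ₑ ^ 2 / ‖p‖ₑ ≤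
      ENNReal.ofReal (-Real.log s) ^ 2 * ∫⁻ p, ‖deriv f p‖ₑ ^ 2 * ENNReal.ofReal p := by
  set h : ℝ → ℝ≥0∞ := fun p => ‖deriv f p‖ₑ ^ 2 * ENNReal.ofReal p with hh
  have hm : Measurable h := ((measurable_deriv f).enorm.pow_const 2).mul (by fun_prop)
  calc _ ≤ ∫⁻ p in Set.Ioi (0 : ℝ), ENNReal.ofReal (-Real.log s) *
          ∫⁻ t in Set.Ioc s 1, h (t * p) :=
        setLIntegral_mono' measurableSet_Ioi fun p hp => enorm_sub_sq_le hf h0 hs hp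
    _ ≤ ∫⁻ p, ENNReal.ofReal (-Real.log s) * ∫⁻ t in Set.Ioc s 1, h (t * p) :=
        setLIntegral_le_lintegral _ _
    _ = ENNReal.ofReal (-Real.log s) * ∫⁻ t in Set.Ioc s 1, ∫⁻ p, h (t * p) := by
        rw [lintegral_const_mul' _ _ ENNReal.ofReal_ne_top, lintegral_lintegral_swap]
        exact (hm.comp (measurable_snd.mul measurable_fst)).aemeasurable
    _ = ENNReal.ofReal (-Real.log s) *
          ∫⁻ t in Set.Ioc s 1, ENNReal.ofReal t⁻¹ * ∫⁻ p, h p := by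
        congr 1
        refine setLIntegral_congr_fun measurableSet_Ioc fun t ht => ?_
        have ht0 : 0 < t := h0.trans ht.1
        rw [lintegral_comp_mul_left ht0.ne', abs_of_pos (inv_pos.2 ht0)]
    _ = _ := by
        rw [lintegral_mul_const _ (by fun_prop), lintegral_inv_Ioc h0 hs, pow_two, mul_assoc]

theorem lintegral_eq_Ioi_add_Ioi_neg (G : ℝ → ℝ≥0∞) :
    ∫⁻ x, G x = (∫⁻ x in Set.Ioi (0 : ℝ), G x) + ∫⁻ x in Set.Ioi (0 : ℝ), G (-x) := by
  rw [← lintegral_add_compl G measurableSet_Ioi (A := Set.Ioi (0 : ℝ)), Set.compl_Ioi]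
  congr 1
  rw [setLIntegral_congr Iio_ae_eq_Iic.symm]
  have h := (MeasurePreserving.setLIntegral_comp_emb (Measure.measurePreserving_neg
    (volume : Measure ℝ)) (MeasurableEquiv.neg ℝ).measurableEmbedding G (Set.Ioi 0)).symm
  have e : Neg.neg '' Set.Ioi (0 : ℝ) = Set.Iio 0 := by simp
  rw [e] at h
  exact h

/-- The dilation factors `s` contribute with the weight `log² s / (1 - s)²`, which is bounded near
`s = 1` and integrable near `s = 0`. -/
theorem neg_log_sq_div_le {s : ℝ} (h0 : 0 < s) (hs : s < 1) :
    ((1 - s) ^ 2)⁻¹ * (-Real.log s) ^ 2 ≤ 16 * s ^ (-(1 / 2) : ℝ) := by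
  set y := s ^ (-(1 / 4) : ℝ) with hy
  have hy0 : 0 < y := Real.rpow_pos_of_pos h0 _
  have h1 : -(1 / 4) * Real.log s ≤ y - 1 := by
    rw [← Real.log_rpow h0]; exact Real.log_le_sub_one_of_pos hy0
  have h2 : y * s ≤ 1 := by
    have : y * s = s ^ (3 / 4 : ℝ) := by
      rw [hy, ← Real.rpow_add_one h0.ne']; norm_num
    rw [this]; exact Real.rpow_le_one h0.le hs.le (by norm_num)
  have h3 : s ^ (-(1 / 2) : ℝ) = y ^ 2 := by
    rw [hy, ← Real.rpow_natCast, ← Real.rpow_mul h0.le]; norm_num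
  have h4 : -Real.log s ≤ 4 * y * (1 - s) := by nlinarith
  have h5 : 0 ≤ -Real.log s := by linarith [Real.log_nonpos h0.le hs.le]
  have h6 : (-Real.log s) ^ 2 ≤ (4 * y * (1 - s)) ^ 2 := pow_le_pow_left₀ h5 h4 2
  rw [h3, inv_mul_le_iff₀ (by nlinarith)]
  nlinarith

/-- The energy over pairs `0 < q < p` is finite: substitute `q = s p` and integrate the estimate for
the dilation by `s` over `s`. -/
theorem lintegral_lintegral_Ioo_lt_top {f : ℝ → ℂ} (hf : Differentiable ℝ f)
    (h : ∫⁻ p, ‖deriv f p‖ₑ ^ 2 * ENNReal.ofReal p < ∞) :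
    ∫⁻ p in Set.Ioi (0 : ℝ), ∫⁻ q in Set.Ioo 0 p, ‖f p - f q‖ₑ ^ 2 / ‖p - q‖ₑ ^ 2 < ∞ := by
  have hfm : Measurable f := hf.continuous.measurable
  set c : ℝ → ℝ≥0∞ := fun s => ENNReal.ofReal ((1 - s) ^ 2)⁻¹ with hc
  have hcm : Measurable c := by fun_prop
  have hdm : Measurable fun z : ℝ × ℝ => c z.2 * (‖f z.1 - f (z.2 * z.1)‖ₑ ^ 2 / ‖z.1‖ₑ) := by
    fun_prop
  have e : ∀ p ∈ Set.Ioi (0 : ℝ), ∫⁻ q in Set.Ioo 0 p, ‖f p - f q‖ₑ ^ 2 / ‖p - q‖ₑ ^ 2 =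
      ∫⁻ s in Set.Ioo (0 : ℝ) 1, c s * (‖f p - f (s * p)‖ₑ ^ 2 / ‖p‖ₑ) := by
    intro p hp
    have hp' : 0 < p := hp
    have hpe : ‖p‖ₑ ≠ 0 := by simpa using hp'.ne'
    set G : ℝ → ℝ≥0∞ := (Set.Ioo 0 p).indicator fun q => ‖f p - f q‖ₑ ^ 2 / ‖p - q‖ₑ ^ 2 with hG
    have h1 := lintegral_comp_mul_left hp'.ne' G
    have h2 : ‖p‖ₑ * ∫⁻ s, G (p * s) = ∫⁻ q, G q := by
      rw [h1, ← Real.norm_eq_abs, ofReal_norm, enorm_inv hp'.ne', ← mul_assoc,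
        ENNReal.mul_inv_cancel hpe enorm_ne_top, one_mul]
    rw [← lintegral_indicator measurableSet_Ioo, ← h2, ← lintegral_const_mul' _ _ enorm_ne_top,
      ← lintegral_indicator measurableSet_Ioo]
    refine lintegral_congr fun s => ?_
    by_cases hs : s ∈ Set.Ioo (0 : ℝ) 1
    · have hps : p * s ∈ Set.Ioo 0 p := ⟨mul_pos hp' hs.1, by nlinarith [hs.2]⟩
      have h3 : ‖p - p * s‖ₑ = ‖p‖ₑ * ENNReal.ofReal (1 - s) := by
        rw [← mul_one_sub, enorm_mul, ← ofReal_norm (1 - s),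
          Real.norm_of_nonneg (by linarith [hs.2])]
      have h4 : ENNReal.ofReal (1 - s) ≠ 0 := by simpa using hs.2
      have h5 : c s = (ENNReal.ofReal (1 - s) ^ 2)⁻¹ := by
        rw [hc, ← ENNReal.ofReal_pow (by linarith [hs.2]), ← ENNReal.ofReal_inv_of_pos]
        exact pow_pos (by linarith [hs.2]) 2
      rw [Set.indicator_of_mem hs, hG, Set.indicator_of_mem hps, h3, mul_pow, mul_comm s p, h5,
        div_eq_mul_inv, div_eq_mul_inv, ENNReal.mul_inv (Or.inl (pow_ne_zero 2 hpe))
          (Or.inl (ENNReal.pow_ne_top enorm_ne_top))]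
      have h6 : ‖p‖ₑ * (‖p‖ₑ ^ 2)⁻¹ = ‖p‖ₑ⁻¹ := by
        rw [pow_two, ENNReal.mul_inv (Or.inl hpe) (Or.inl enorm_ne_top), ← mul_assoc,
          ENNReal.mul_inv_cancel hpe enorm_ne_top, one_mul]
      rw [← h6]
      ring
    · have hps : p * s ∉ Set.Ioo 0 p := fun hps =>
        hs ⟨(mul_pos_iff_of_pos_left hp').1 hps.1, by nlinarith [hps.2]⟩
      rw [Set.indicator_of_notMem hs, hG, Set.indicator_of_notMem hps, mul_zero]
  rw [setLIntegral_congr_fun measurableSet_Ioi e, lintegral_lintegral_swap hdm.aemeasurable]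
  set H := ∫⁻ p, ‖deriv f p‖ₑ ^ 2 * ENNReal.ofReal p
  have hb : ∀ s ∈ Set.Ioo (0 : ℝ) 1,
      ∫⁻ p in Set.Ioi (0 : ℝ), c s * (‖f p - f (s * p)‖ₑ ^ 2 / ‖p‖ₑ) ≤
        ENNReal.ofReal (16 * s ^ (-(1 / 2) : ℝ)) * H := by
    intro s hs
    rw [lintegral_const_mul' _ _ ENNReal.ofReal_ne_top]
    refine (mul_le_mul_right (lintegral_dilation_le_deriv hf hs.1 hs.2) _).trans ?_
    rw [← mul_assoc, ← ENNReal.ofReal_pow (by linarith [Real.log_nonpos hs.1.le hs.2.le]),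
      ← ENNReal.ofReal_mul (by positivity)]
    exact mul_le_mul_left (ENNReal.ofReal_le_ofReal (neg_log_sq_div_le hs.1 hs.2)) _
  refine lt_of_le_of_lt (setLIntegral_mono' measurableSet_Ioo hb) ?_
  rw [lintegral_mul_const' _ _ h.ne]
  refine ENNReal.mul_lt_top (IntegrableOn.setLIntegral_lt_top ?_) h
  refine Integrable.const_mul ?_ _
  rw [← IntegrableOn, ← intervalIntegrable_iff_integrableOn_Ioo_of_le zero_le_one]
  exact intervalIntegral.intervalIntegrable_rpow' (by norm_num)

/-- An even differentiable function with `∫₀^∞ |f'(p)|² p dp < ∞` has finite energy. The weight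
`ENNReal.ofReal p` vanishes for `p ≤ 0`. -/
theorem energy_lt_top_of_even {f : ℝ → ℂ} (hf : Differentiable ℝ f) (he : Function.Even f)
    (h : ∫⁻ p, ‖deriv f p‖ₑ ^ 2 * ENNReal.ofReal p < ∞) : energy f < ∞ := by
  have hfm : Measurable f := hf.continuous.measurable
  set E : ℝ → ℝ → ℝ≥0∞ := fun q p => ‖f p - f q‖ₑ ^ 2 / ‖p - q‖ₑ ^ 2 with hE
  have hEm : Measurable (Function.uncurry E) := by
    simpa [hE, Function.uncurry_def] using measurable_energy_integrand hfm
  set D := ∫⁻ p in Set.Ioi (0 : ℝ), ∫⁻ q in Set.Ioo 0 p, E q p with hD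
  have hDf : D < ∞ := lintegral_lintegral_Ioo_lt_top hf h
  have hsymm : ∀ q p, E q p = E p q := fun q p => by
    simp only [hE, enorm_sub_rev (f p), enorm_sub_rev p]
  have hneg : ∀ q p, E (-q) p = E q (-p) := fun q p => by
    simp only [hE, he q, he p]
    congr 2
    rw [← enorm_neg]
    congr 1
    ring
  -- reflecting one of two positive points increases their distance
  have hpos : ∀ q > 0, ∀ p > 0, E q (-p) ≤ E q p := fun q hq p hp => by
    simp only [hE, he p]
    have : ‖p - q‖ₑ ≤ ‖-p - q‖ₑ := by
      rw [enorm_le_iff_norm_le, Real.norm_eq_abs, Real.norm_eq_abs, abs_le]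
      rw [abs_of_neg (by linarith)]
      constructor <;> linarith
    gcongr
  have hA : ∀ q > 0, (∫⁻ p, E q p ≤ 2 * ∫⁻ p in Set.Ioi (0 : ℝ), E q p) ∧
      ∫⁻ p, E (-q) p ≤ 2 * ∫⁻ p in Set.Ioi (0 : ℝ), E q p := by
    intro q hq
    have h1 : ∫⁻ p in Set.Ioi (0 : ℝ), E q (-p) ≤ ∫⁻ p in Set.Ioi (0 : ℝ), E q p :=
      setLIntegral_mono' measurableSet_Ioi fun p hp => hpos q hq p hp
    constructor
    · rw [lintegral_eq_Ioi_add_Ioi_neg, two_mul]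
      gcongr
    · rw [lintegral_eq_Ioi_add_Ioi_neg, two_mul, add_comm]
      simp_rw [hneg, neg_neg]
      gcongr
  have h1 : energy f ≤ 4 * ∫⁻ q in Set.Ioi (0 : ℝ), ∫⁻ p in Set.Ioi (0 : ℝ), E q p := by
    have : energy f = ∫⁻ q, ∫⁻ p, E q p := rfl
    rw [this, lintegral_eq_Ioi_add_Ioi_neg, show (4 : ℝ≥0∞) = 2 + 2 by norm_num, add_mul,
      ← lintegral_const_mul' 2 _ (by simp)]
    exact add_le_add (setLIntegral_mono' measurableSet_Ioi fun q hq => (hA q hq).1)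
      (setLIntegral_mono' measurableSet_Ioi fun q hq => (hA q hq).2)
  have hS : MeasurableSet {z : ℝ × ℝ | 0 < z.1 ∧ z.1 < z.2} :=
    (measurableSet_lt measurable_const measurable_fst).inter
      (measurableSet_lt measurable_fst measurable_snd)
  set U : ℝ × ℝ → ℝ≥0∞ := {z : ℝ × ℝ | 0 < z.1 ∧ z.1 < z.2}.indicator (Function.uncurry E) with hU
  have hUm : Measurable U := hEm.indicator hS
  have hDU : D = ∫⁻ p, ∫⁻ q, U (q, p) := by
    rw [hD, ← lintegral_indicator measurableSet_Ioi]
    refine lintegral_congr fun p => ?_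
    by_cases hp : p ∈ Set.Ioi (0 : ℝ)
    · rw [Set.indicator_of_mem hp, ← lintegral_indicator measurableSet_Ioo]
      refine lintegral_congr fun q => ?_
      simp [hU, Set.indicator_apply, Function.uncurry]
    · rw [Set.indicator_of_notMem hp]
      refine (lintegral_eq_zero_of_ae_eq_zero (Eventually.of_forall fun q => ?_)).symm
      refine Set.indicator_of_notMem (fun hq => hp ?_) _
      exact hq.1.trans hq.2
  have h2 : ∫⁻ q in Set.Ioi (0 : ℝ), ∫⁻ p in Set.Ioi (0 : ℝ), E q p ≤ D + D := by
    calc _ ≤ ∫⁻ q, ∫⁻ p, (U (q, p) + U (p, q)) := by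
          rw [← lintegral_indicator measurableSet_Ioi]
          refine lintegral_mono fun q => ?_
          refine Set.indicator_apply_le' (fun hq => ?_) (fun _ => bot_le)
          rw [← lintegral_indicator measurableSet_Ioi]
          refine lintegral_mono fun p => ?_
          refine Set.indicator_apply_le' (fun hp => ?_) (fun _ => bot_le)
          rcases lt_trichotomy q p with hqp | rfl | hqp
          · refine le_trans (le_of_eq ?_) le_self_add
            exact (Set.indicator_of_mem (show (q, p) ∈ {z : ℝ × ℝ | 0 < z.1 ∧ z.1 < z.2} from
              ⟨hq, hqp⟩) (Function.uncurry E)).symm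
          · simp [hE]
          · refine le_trans (le_of_eq ?_) le_add_self
            rw [hsymm]
            exact (Set.indicator_of_mem (show (p, q) ∈ {z : ℝ × ℝ | 0 < z.1 ∧ z.1 < z.2} from
              ⟨hp, hqp⟩) (Function.uncurry E)).symm
      _ = D + D := by
          refine (lintegral_lintegral_add (H := fun z => U z.swap) hUm).trans ?_
          rw [lintegral_lintegral_swap (f := fun q p => U (q, p)) hUm.aemeasurable, hDU]
          rfl
  exact (h1.trans (mul_le_mul_right h2 4)).trans_lt
    (ENNReal.mul_lt_top (by simp) (ENNReal.add_lt_top.2 ⟨hDf, hDf⟩))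

end EvenDifferentiable

/-! ### Translations and the Fourier transform -/

section Translations
open Filter Topology

/-- The product `x ↦ x g(x)` of a Schwartz function with the coordinate. -/
def schwartzCoordMul (g : 𝓢(ℝ, ℂ)) : 𝓢(ℝ, ℂ) :=
  SchwartzMap.smulLeftCLM ℂ (fun x : ℝ => (x : ℂ)) g

theorem schwartzCoordMul_apply (g : 𝓢(ℝ, ℂ)) (x : ℝ) : schwartzCoordMul g x = x * g x := by
  rw [schwartzCoordMul, SchwartzMap.smulLeftCLM_apply_apply hasTemperateGrowth_coord, smul_eq_mul]

/-- The product of a Schwartz function with the character `x ↦ exp(2πisx)`, defined by translating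
the Fourier transform. -/
def schwartzModulate (s : ℝ) (g : 𝓢(ℝ, ℂ)) : 𝓢(ℝ, ℂ) :=
  𝓕⁻ (SchwartzMap.compSubConstCLM ℂ s (𝓕 g))

theorem fourier_schwartzModulate (s : ℝ) (g : 𝓢(ℝ, ℂ)) (ξ : ℝ) :
    𝓕 (schwartzModulate s g) ξ = 𝓕 g (ξ - s) := by
  rw [schwartzModulate, FourierTransform.fourier_fourierInv_eq, compSubConstCLM_apply]

theorem schwartzModulate_apply (s : ℝ) (g : 𝓢(ℝ, ℂ)) (x : ℝ) :
    schwartzModulate s g x = Real.fourierChar (s * x) * g x := by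
  rw [schwartzModulate, SchwartzMap.fourierInv_coe, Real.fourierInv_eq]
  have h : ∀ v : ℝ, Real.fourierChar (inner ℝ v x) • (compSubConstCLM ℂ s (𝓕 g)) v =
      (fun v : ℝ => (Real.fourierChar (s * x) : ℂ) *
        (Real.fourierChar (inner ℝ v x) • (𝓕 g : 𝓢(ℝ, ℂ)) v)) (v - s) := by
    intro v
    simp only [compSubConstCLM_apply, Circle.smul_def, smul_eq_mul]
    rw [← mul_assoc, ← Circle.coe_mul, ← AddChar.map_add_eq_mul]
    congr 3
    simp
    ring
  simp_rw [h]
  rw [integral_sub_right_eq_self (fun v : ℝ => (Real.fourierChar (s * x) : ℂ) *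
    (Real.fourierChar (inner ℝ v x) • (𝓕 g : 𝓢(ℝ, ℂ)) v)), integral_const_mul]
  congr 1
  rw [← Real.fourierInv_eq, ← SchwartzMap.fourierInv_coe, FourierTransform.fourierInv_fourier_eq]

theorem schwartzCoordMul_modulate (s : ℝ) (g : 𝓢(ℝ, ℂ)) :
    schwartzCoordMul (schwartzModulate s g) = schwartzModulate s (schwartzCoordMul g) := by
  ext x
  simp only [schwartzCoordMul_apply, schwartzModulate_apply]
  ring

theorem hasDerivAt_fourier_schwartz (g : 𝓢(ℝ, ℂ)) (ξ : ℝ) :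
    HasDerivAt (𝓕 g : 𝓢(ℝ, ℂ)) (-(2 * Real.pi * Complex.I) * 𝓕 (schwartzCoordMul g) ξ) ξ := by
  have h := Real.hasDerivAt_fourier (f := g) g.integrable (by
    refine (schwartzCoordMul g).integrable.congr (Eventually.of_forall fun x => ?_)
    simp [schwartzCoordMul_apply]) ξ
  rw [SchwartzMap.fourier_coe]
  refine h.congr_deriv ?_
  rw [SchwartzMap.fourier_coe, Real.fourier_eq, Real.fourier_eq, ← integral_const_mul]
  refine integral_congr_ae (Eventually.of_forall fun x => ?_)
  simp only [schwartzCoordMul_apply, Circle.smul_def, smul_eq_mul]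
  ring

/-- The translates of a Schwartz function by a bounded amount have a common integrable majorant. -/
theorem exists_norm_translate_le (G : 𝓢(ℝ, ℂ)) :
    ∃ C, ∀ ξ t : ℝ, |t| < 1 → ‖G (ξ - t)‖ ≤ C * (1 + ‖ξ‖) ^ (-2 : ℝ) := by
  refine ⟨4 * (2 ^ 2 * ((Finset.Iic (2, 0)).sup fun m => SchwartzMap.seminorm ℂ m.1 m.2) G),
    fun ξ t ht => ?_⟩
  have h := SchwartzMap.one_add_le_sup_seminorm_apply (𝕜 := ℂ) (m := (2, 0)) le_rfl le_rfl G (ξ - t)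
  rw [norm_iteratedFDeriv_zero] at h
  simp only at h
  set S := (2 ^ 2 * ((Finset.Iic (2, 0)).sup fun m => SchwartzMap.seminorm ℂ m.1 m.2) G)
  have h1 : 1 + ‖ξ‖ ≤ 2 * (1 + ‖ξ - t‖) := by
    have := norm_sub_norm_le ξ t
    have := norm_nonneg (ξ - t)
    rw [← Real.norm_eq_abs] at ht
    linarith
  rw [Real.rpow_neg (by positivity), ← div_eq_mul_inv, le_div_iff₀ (by positivity)]
  norm_cast
  calc ‖G (ξ - t)‖ * (1 + ‖ξ‖) ^ 2 ≤ ‖G (ξ - t)‖ * (2 * (1 + ‖ξ - t‖)) ^ 2 := by gcongr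
    _ = 4 * ((1 + ‖ξ - t‖) ^ 2 * ‖G (ξ - t)‖) := by ring
    _ ≤ 4 * S := by gcongr

variable {f : ℝ → ℂ} {M : ℝ}

theorem integrable_schwartz_mul (hf : Measurable f) (hM : ∀ x, ‖f x‖ ≤ M) (G : 𝓢(ℝ, ℂ)) :
    Integrable fun ξ => G ξ * f ξ :=
  G.integrable.mul_bdd (c := M) hf.aestronglyMeasurable (Eventually.of_forall hM)

/-- Differentiation of the pairing of `f` with the translates of `𝓕 g`. -/
theorem hasDerivAt_pairing_translate (hf : Measurable f) (hM : ∀ x, ‖f x‖ ≤ M) (g : 𝓢(ℝ, ℂ))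
    (s : ℝ) :
    HasDerivAt (fun s => ∫ ξ, 𝓕 g (ξ - s) * f ξ)
      (2 * Real.pi * Complex.I * ∫ ξ, 𝓕 (schwartzCoordMul g) (ξ - s) * f ξ) s := by
  obtain ⟨C, hC⟩ := exists_norm_translate_le
    (SchwartzMap.compSubConstCLM ℂ s (𝓕 (schwartzCoordMul g)))
  have hI : ∀ (G : 𝓢(ℝ, ℂ)) (s : ℝ), Integrable fun ξ => G (ξ - s) * f ξ := fun G s => by
    simpa using integrable_schwartz_mul hf hM (SchwartzMap.compSubConstCLM ℂ s G)
  rw [← integral_const_mul]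
  refine (hasDerivAt_integral_of_dominated_loc_of_deriv_le (Metric.ball_mem_nhds s one_pos)
    (bound := fun ξ => 2 * Real.pi * (C * (1 + ‖ξ‖) ^ (-2 : ℝ) * M))
    (F' := fun s ξ => 2 * Real.pi * Complex.I * (𝓕 (schwartzCoordMul g) (ξ - s) * f ξ))
    (Eventually.of_forall fun s => (hI _ s).aestronglyMeasurable) (hI _ s)
    ((hI _ s).const_mul _).aestronglyMeasurable ?_ ?_ ?_).2
  · refine Eventually.of_forall fun ξ t ht => ?_
    rw [norm_mul, norm_mul _ (f ξ)]
    have h1 : ‖(2 * Real.pi * Complex.I : ℂ)‖ = 2 * Real.pi := by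
      simp [abs_of_pos Real.pi_pos]
    have h2 := hC ξ (t - s) (by simpa [Real.dist_eq] using ht)
    rw [compSubConstCLM_apply, show ξ - (t - s) - s = ξ - t by ring] at h2
    rw [h1]
    have := hM ξ
    gcongr
    exact (norm_nonneg _).trans h2
  · exact (((integrable_one_add_norm (by simp)).const_mul C).mul_const M).const_mul _
  · refine Eventually.of_forall fun ξ t ht => ?_
    have h := ((hasDerivAt_fourier_schwartz g (ξ - t)).scomp t
      ((hasDerivAt_id' t).const_sub ξ)).mul_const (f ξ)
    refine h.congr_deriv ?_
    rw [neg_one_smul]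
    ring

/-- `phase h x = exp(2πihx) - 1`, the Fourier symbol of the difference operator
`f ↦ f(· + h) - f`. -/
def phase (h x : ℝ) : ℂ := Real.fourierChar (h * x) - 1

theorem hasDerivAt_phase (h x : ℝ) :
    HasDerivAt (fun h => phase h x) (2 * Real.pi * Complex.I * x * Real.fourierChar (h * x)) h := by
  have := ((Real.hasDerivAt_fourierChar (h * x)).scomp h ((hasDerivAt_id h).mul_const x)).sub_const 1
  refine this.congr_deriv ?_
  rw [one_mul, Complex.real_smul]
  ring

theorem norm_phase_le (h x : ℝ) : ‖phase h x‖ ≤ 2 * Real.pi * |h * x| := by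
  have := Real.norm_exp_I_mul_ofReal_sub_one_le (x := 2 * Real.pi * (h * x))
  rw [mul_comm Complex.I, ← Real.fourierChar_apply] at this
  simpa [phase, abs_mul, abs_of_pos Real.pi_pos] using this

theorem norm_phase_le_two (h x : ℝ) : ‖phase h x‖ ≤ 2 := by
  refine (norm_sub_le _ _).trans ?_
  rw [Circle.norm_coe, norm_one]
  norm_num

theorem measurable_phase : Measurable fun z : ℝ × ℝ => phase z.1 z.2 := by
  have : Continuous fun z : ℝ × ℝ => phase z.1 z.2 := by
    unfold phase
    have := Real.continuous_fourierChar
    fun_prop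
  exact this.measurable

theorem measurable_phase_right (h : ℝ) : Measurable (phase h) :=
  measurable_phase.comp (measurable_const.prodMk measurable_id)

theorem phase_ne_zero_ae {h : ℝ} (hh : h ≠ 0) : ∀ᵐ x, phase h x ≠ 0 := by
  have hc : (Set.range fun n : ℤ => (n : ℝ) / h).Countable := Set.countable_range _
  filter_upwards [hc.ae_notMem volume] with x hx h0
  rw [phase, sub_eq_zero, Real.fourierChar_apply, Complex.exp_eq_one_iff] at h0
  obtain ⟨n, hn⟩ := h0
  refine hx ⟨n, ?_⟩
  have hpi : (2 * Real.pi * Complex.I : ℂ) ≠ 0 := by simp [Real.pi_ne_zero]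
  have : (h * x : ℂ) = n := by
    apply mul_right_cancel₀ hpi
    rw [← hn]
    push_cast
    ring
  have : h * x = n := by exact_mod_cast this
  simp only
  rw [← this]
  field_simp

variable {u : ℝ → ℂ}

theorem integrable_phase_mul (hu : Measurable u) {g : 𝓢(ℝ, ℂ)}
    (hi : Integrable fun x => g x * (x * u x)) (h : ℝ) :
    Integrable fun x => g x * (phase h x * u x) := by
  refine Integrable.mono' (hi.norm.const_mul (2 * Real.pi * |h|))
    (g.continuous.measurable.mul ((measurable_phase_right h).mul hu)).aestronglyMeasurable
    (Eventually.of_forall fun x => ?_)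
  have := norm_phase_le h x
  simp only [norm_mul, Complex.norm_real, Real.norm_eq_abs, abs_mul] at this ⊢
  calc ‖g x‖ * (‖phase h x‖ * ‖u x‖) ≤ ‖g x‖ * (2 * Real.pi * (|h| * |x|) * ‖u x‖) := by gcongr
    _ = _ := by ring

/-- Differentiation in `s` of the pairing of `phase s · u` with `g`; this only requires `x u` to be
integrable against `g`, as `phase s` vanishes at `x = 0`. -/
theorem hasDerivAt_pairing_phase (hu : Measurable u) {g : 𝓢(ℝ, ℂ)}
    (hi : Integrable fun x => g x * (x * u x)) (s : ℝ) :
    HasDerivAt (fun s => ∫ x, g x * (phase s x * u x))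
      (2 * Real.pi * Complex.I * ∫ x, Real.fourierChar (s * x) * (g x * (x * u x))) s := by
  rw [← integral_const_mul]
  have hm : AEStronglyMeasurable
      (fun x => 2 * Real.pi * Complex.I * (Real.fourierChar (s * x) * (g x * (x * u x)))) := by
    have hc : Continuous fun x : ℝ => (Real.fourierChar (s * x) : ℂ) := by
      have := Real.continuous_fourierChar
      fun_prop
    exact ((hc.aestronglyMeasurable).mul hi.aestronglyMeasurable).const_mul _
  refine (hasDerivAt_integral_of_dominated_loc_of_deriv_le (Metric.ball_mem_nhds s one_pos)
    (bound := fun x => 2 * Real.pi * ‖g x * (x * u x)‖)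
    (F' := fun s x => 2 * Real.pi * Complex.I * (Real.fourierChar (s * x) * (g x * (x * u x))))
    (Eventually.of_forall fun s => (integrable_phase_mul hu hi s).aestronglyMeasurable)
    (integrable_phase_mul hu hi s) hm ?_ (hi.norm.const_mul _) ?_).2
  · refine Eventually.of_forall fun x t _ => le_of_eq ?_
    rw [norm_mul, norm_mul (Real.fourierChar (t * x) : ℂ), Circle.norm_coe]
    simp [abs_of_pos Real.pi_pos]
  · refine Eventually.of_forall fun x t ht => ?_
    refine (((hasDerivAt_phase t x).mul_const (u x)).const_mul (g x)).congr_deriv ?_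
    ring

theorem integral_fourier_mul_sub (hf : Measurable f) (hM : ∀ x, ‖f x‖ ≤ M) (g : 𝓢(ℝ, ℂ)) (h : ℝ) :
    ∫ ξ, 𝓕 g ξ * (f (ξ + h) - f ξ) = (∫ ξ, 𝓕 g (ξ - h) * f ξ) - ∫ ξ, 𝓕 g (ξ - 0) * f ξ := by
  have e : ∫ ξ, 𝓕 g (ξ - h) * f ξ = ∫ ξ, 𝓕 g ξ * f (ξ + h) := by
    rw [← integral_add_right_eq_self _ h]
    simp
  rw [e, ← integral_sub]
  · simp [mul_sub]
  · exact integrable_schwartz_mul (hf.comp (measurable_add_const h)) (fun x => hM _) (𝓕 g)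
  · simpa using integrable_schwartz_mul hf hM (𝓕 g)

/-- If `x u(x)` is the product of the coordinate with the Fourier transform of `f`, then `phase h · u` is
the Fourier transform of `f(· + h) - f`: both sides are differentiable in `h`, with the same
derivative, and vanish for `h = 0`. -/
theorem integral_fourier_mul_sub_eq (hf : Measurable f) (hM : ∀ x, ‖f x‖ ≤ M) (hu : Measurable u)
    (hi : ∀ g : 𝓢(ℝ, ℂ), Integrable fun x => g x * (x * u x))
    (h : ∀ g : 𝓢(ℝ, ℂ), ∫ ξ, 𝓕 (schwartzCoordMul g) ξ * f ξ = ∫ x, g x * (x * u x))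
    (g : 𝓢(ℝ, ℂ)) (s : ℝ) :
    ∫ ξ, 𝓕 g ξ * (f (ξ + s) - f ξ) = ∫ x, g x * (phase s x * u x) := by
  have hd : ∀ s, HasDerivAt (fun s => (∫ ξ, 𝓕 g (ξ - s) * f ξ) - ∫ x, g x * (phase s x * u x)) 0 s := by
    intro s
    refine ((hasDerivAt_pairing_translate hf hM g s).sub
      (hasDerivAt_pairing_phase hu (hi g) s)).congr_deriv ?_
    -- The two derivatives agree by the hypothesis for the test function `exp(2πisx) g(x)`.
    have e := h (schwartzModulate s g)
    rw [schwartzCoordMul_modulate] at e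
    simp_rw [fourier_schwartzModulate, schwartzModulate_apply, mul_assoc] at e
    rw [e, sub_self]
  have hc := is_const_of_deriv_eq_zero (fun s => (hd s).differentiableAt) (fun s => (hd s).deriv) s 0
  rw [integral_fourier_mul_sub hf hM]
  have h0 : ∫ x, g x * (phase 0 x * u x) = 0 := by simp [phase]
  simp only [h0] at hc
  linear_combination hc

/-- Conversely, the identity for the differences `f(· + h) - f` for a set of `h` accumulating at `0`
gives back, upon differentiation at `h = 0`, the identity for `f` itself. -/
theorem integral_fourier_coordMul_eq (hf : Measurable f) (hM : ∀ x, ‖f x‖ ≤ M) (hu : Measurable u)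
    (g : 𝓢(ℝ, ℂ)) (hi : Integrable fun x => g x * (x * u x))
    (h : ∃ᶠ s in 𝓝[≠] (0 : ℝ),
      ∫ ξ, 𝓕 g ξ * (f (ξ + s) - f ξ) = ∫ x, g x * (phase s x * u x)) :
    ∫ ξ, 𝓕 (schwartzCoordMul g) ξ * f ξ = ∫ x, g x * (x * u x) := by
  have hd := ((hasDerivAt_pairing_translate hf hM g 0).sub
    (hasDerivAt_pairing_phase hu hi 0)).tendsto_slope
  have h0 : ∫ x, g x * (phase 0 x * u x) = 0 := by simp [phase]
  have := isClosed_singleton.mem_of_frequently_of_tendsto (s := {(0 : ℂ)}) (h.mono fun s hs => ?_) hd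
  · rw [Set.mem_singleton_iff, ← mul_sub] at this
    have hpi : (2 * Real.pi * Complex.I : ℂ) ≠ 0 := by simp [Real.pi_ne_zero]
    simpa using sub_eq_zero.1 ((mul_eq_zero.1 this).resolve_left hpi)
  · rw [integral_fourier_mul_sub hf hM] at hs
    rw [Set.mem_singleton_iff, slope_def_module]
    simp only [Pi.sub_apply, h0]
    rw [← hs]
    simp
end Translations

/-! ### Finite energy and the regular part of the Fourier transform -/

section RegularPart
open Filter Topology

/-- Plancherel's identity for functions that form a Fourier pair in the sense of distributions. -/
theorem lintegral_enorm_sq_eq_of_pairing {d v : ℝ → ℂ} (hd : LocallyIntegrable d) (hv : MemLp v 2)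
    (h : ∀ g : 𝓢(ℝ, ℂ), ∫ ξ, 𝓕 g ξ * d ξ = ∫ x, g x * v x) :
    ∫⁻ ξ, ‖d ξ‖ₑ ^ 2 = ∫⁻ x, ‖v x‖ₑ ^ 2 := by
  have e : d =ᵐ[volume] (𝓕⁻ (hv.toLp v) : Lp ℂ 2 (volume : Measure ℝ)) := by
    refine ae_eq_of_schwartz_pairing hd ((Lp.memLp _).locallyIntegrable (by norm_num)) fun g => ?_
    have h1 := DFunLike.congr_fun (Lp.fourierInv_toTemperedDistribution_eq (hv.toLp v)) g
    rw [TemperedDistribution.fourierInv_apply, Lp.toTemperedDistribution_apply,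
      Lp.toTemperedDistribution_apply] at h1
    have h2 := h (𝓕⁻ g)
    rw [FourierTransform.fourier_fourierInv_eq] at h2
    rw [← h1]
    refine h2.trans (integral_congr_ae ?_)
    filter_upwards [hv.coeFn_toLp] with x hx
    rw [hx, smul_eq_mul]
  calc ∫⁻ ξ, ‖d ξ‖ₑ ^ 2
      = ∫⁻ ξ, ‖(𝓕⁻ (hv.toLp v) : Lp ℂ 2 (volume : Measure ℝ)) ξ‖ₑ ^ 2 := by
        refine lintegral_congr_ae ?_
        filter_upwards [e] with x hx
        rw [hx]
    _ = ‖hv.toLp v‖ₑ ^ 2 := by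
        rw [lintegral_enorm_sq_eq_enorm_sq, ← ofReal_norm, ← Lp.norm_fourier_eq,
          FourierTransform.fourier_fourierInv_eq, ofReal_norm]
    _ = _ := by
        rw [← lintegral_enorm_sq_eq_enorm_sq]
        refine lintegral_congr_ae ?_
        filter_upwards [hv.coeFn_toLp] with x hx
        rw [hx]

/-- A square integrable function `d` has a measurable, square integrable Fourier transform `D`, in
the sense of distributions. -/
theorem exists_fourier_pair {d : ℝ → ℂ} (hd : MemLp d 2) :
    ∃ D : ℝ → ℂ, Measurable D ∧ MemLp D 2 ∧ ∀ g : 𝓢(ℝ, ℂ), ∫ ξ, 𝓕 g ξ * d ξ = ∫ x, g x * D x := by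
  refine ⟨(𝓕 (hd.toLp d) : Lp ℂ 2 (volume : Measure ℝ)), (Lp.stronglyMeasurable _).measurable,
    Lp.memLp _, fun g => ?_⟩
  have h1 := DFunLike.congr_fun (Lp.fourier_toTemperedDistribution_eq (hd.toLp d)) g
  rw [TemperedDistribution.fourier_apply, Lp.toTemperedDistribution_apply,
    Lp.toTemperedDistribution_apply] at h1
  refine Eq.trans (integral_congr_ae ?_) h1
  filter_upwards [hd.coeFn_toLp] with x hx
  rw [hx, smul_eq_mul]

theorem energy_eq_lintegral_translate {f : ℝ → ℂ} (hf : Measurable f) :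
    energy f = ∫⁻ h, (∫⁻ q, ‖f (q + h) - f q‖ₑ ^ 2) / ‖h‖ₑ ^ 2 := by
  have hm : Measurable fun z : ℝ × ℝ => ‖f (z.1 + z.2) - f z.1‖ₑ ^ 2 / ‖z.2‖ₑ ^ 2 := by
    fun_prop
  have e : ∀ q, ∫⁻ p, ‖f p - f q‖ₑ ^ 2 / ‖p - q‖ₑ ^ 2 =
      ∫⁻ h, ‖f (q + h) - f q‖ₑ ^ 2 / ‖h‖ₑ ^ 2 := by
    intro q
    rw [← lintegral_add_left_eq_self (fun p => ‖f p - f q‖ₑ ^ 2 / ‖p - q‖ₑ ^ 2) q]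
    simp
  rw [energy]
  simp_rw [e]
  rw [lintegral_lintegral_swap hm.aemeasurable]
  refine lintegral_congr fun h => ?_
  simp_rw [div_eq_mul_inv]
  rw [lintegral_mul_const]
  fun_prop

/-- The constant relating the energy of a function to the weighted norm of its Fourier transform. -/
def phaseConst : ℝ≥0∞ := ∫⁻ t : ℝ, ‖phase 1 t‖ₑ ^ 2 / ‖t‖ₑ ^ 2

theorem phaseConst_ne_zero : phaseConst ≠ 0 := by
  have hm : Measurable fun t : ℝ => ‖phase 1 t‖ₑ ^ 2 / ‖t‖ₑ ^ 2 := by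
    have := measurable_phase_right 1
    fun_prop
  intro h
  rw [phaseConst, lintegral_eq_zero_iff hm] at h
  have : ∀ᵐ _ : ℝ, False := by
    filter_upwards [h, phase_ne_zero_ae one_ne_zero] with t h1 h2
    simp [ENNReal.div_eq_zero_iff, h2] at h1
  exact this.exists.elim fun _ => id

theorem phaseConst_lt_top : phaseConst < ∞ := by
  have hi : Integrable fun t : ℝ => (4 * Real.pi ^ 2 + 4) * (1 + t ^ 2)⁻¹ :=
    integrable_inv_one_add_sq.const_mul _
  refine lt_of_le_of_lt (lintegral_mono fun t => ?_) hi.lintegral_lt_top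
  rcases eq_or_ne t 0 with rfl | ht
  · simp [phase]
  -- The integrand is bounded by `4π²` and by `4 / t²`.
  rw [← ofReal_norm, ← ofReal_norm, ← ENNReal.ofReal_pow (norm_nonneg _),
    ← ENNReal.ofReal_pow (norm_nonneg _), ← ENNReal.ofReal_div_of_pos (by positivity)]
  refine ENNReal.ofReal_le_ofReal ?_
  rw [← div_eq_mul_inv, div_le_div_iff₀ (by positivity) (by positivity)]
  have h1 := norm_phase_le 1 t
  have h2 := norm_phase_le_two 1 t
  rw [one_mul] at h1
  rw [Real.norm_eq_abs]
  have h3 : ‖phase 1 t‖ ^ 2 ≤ (2 * Real.pi * |t|) ^ 2 := by gcongr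
  have h4 : ‖phase 1 t‖ ^ 2 ≤ 2 ^ 2 := by gcongr
  rw [mul_pow] at h3
  rw [sq_abs] at h3 ⊢
  nlinarith [sq_nonneg t]

/-- Scaling `h` by `x` makes the integral over `h` proportional to `|x|`. -/
theorem lintegral_phase_sq (x : ℝ) :
    ∫⁻ h, ‖phase h x‖ₑ ^ 2 / ‖h‖ₑ ^ 2 = phaseConst * ‖x‖ₑ := by
  rcases eq_or_ne x 0 with rfl | hx
  · simp [phase]
  have hx0 : ‖x‖ₑ ≠ 0 := by simpa using hx
  have h := lintegral_comp_mul_left hx (fun t : ℝ => ‖phase 1 t‖ₑ ^ 2 / ‖t‖ₑ ^ 2)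
  have e : ∀ t, ‖phase t x‖ₑ ^ 2 / ‖t‖ₑ ^ 2 =
      ‖x‖ₑ ^ 2 * (‖phase 1 (x * t)‖ₑ ^ 2 / ‖x * t‖ₑ ^ 2) := by
    intro t
    have : phase 1 (x * t) = phase t x := by simp [phase, mul_comm]
    rw [this, enorm_mul, mul_pow, ← mul_div_assoc,
      ENNReal.mul_div_mul_left _ _ (by simpa using hx) (ENNReal.pow_ne_top enorm_ne_top)]
  simp_rw [e]
  rw [lintegral_const_mul' _ _ (ENNReal.pow_ne_top enorm_ne_top), h, ← phaseConst, ← mul_assoc,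
    mul_comm]
  congr 1
  rw [← Real.norm_eq_abs, ofReal_norm, enorm_inv hx, pow_two, mul_assoc,
    ENNReal.mul_inv_cancel hx0 enorm_ne_top, mul_one]

/-- The weighted norm `∫ |x| |u(x)|² dx` as an integral over the norms of `phase h · u`. -/
theorem lintegral_phase_mul_sq {u : ℝ → ℂ} (hu : Measurable u) :
    ∫⁻ h, (∫⁻ x, ‖phase h x * u x‖ₑ ^ 2) / ‖h‖ₑ ^ 2 = phaseConst * ∫⁻ x, ‖x‖ₑ * ‖u x‖ₑ ^ 2 := by
  have hm : Measurable fun z : ℝ × ℝ => ‖phase z.1 z.2 * u z.2‖ₑ ^ 2 / ‖z.1‖ₑ ^ 2 := by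
    have := measurable_phase
    fun_prop
  calc _ = ∫⁻ h, ∫⁻ x, ‖phase h x * u x‖ₑ ^ 2 / ‖h‖ₑ ^ 2 := by
        refine lintegral_congr fun h => ?_
        simp_rw [div_eq_mul_inv]
        rw [lintegral_mul_const]
        have := measurable_phase_right h
        fun_prop
    _ = ∫⁻ x, ∫⁻ h, ‖phase h x * u x‖ₑ ^ 2 / ‖h‖ₑ ^ 2 :=
        lintegral_lintegral_swap hm.aemeasurable
    _ = ∫⁻ x, phaseConst * (‖x‖ₑ * ‖u x‖ₑ ^ 2) := by
        refine lintegral_congr fun x => ?_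
        rw [← mul_assoc, ← lintegral_phase_sq, ← lintegral_mul_const' _ _
          (ENNReal.pow_ne_top enorm_ne_top)]
        refine lintegral_congr fun h => ?_
        rw [enorm_mul, mul_pow, ENNReal.mul_div_right_comm]
    _ = _ := lintegral_const_mul' _ _ phaseConst_lt_top.ne

/-- If `∫ |x| |u(x)|² dx` is finite, then `x u(x)` is integrable against Schwartz functions. -/
theorem integrable_schwartz_mul_coord {u : ℝ → ℂ} (hu : Measurable u)
    (h : ∫⁻ x, ‖x‖ₑ * ‖u x‖ₑ ^ 2 < ∞) (g : 𝓢(ℝ, ℂ)) : Integrable fun x => g x * (x * u x) := by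
  have h1 : Integrable fun x : ℝ => |x| * ‖u x‖ ^ 2 := by
    refine ⟨by fun_prop, ?_⟩
    rw [hasFiniteIntegral_iff_enorm]
    refine lt_of_eq_of_lt (lintegral_congr fun x => ?_) h
    simp [enorm_mul]
  have h2 : Integrable fun x : ℝ => |x| * ‖g x‖ ^ 2 := by
    have hb : Integrable fun x : ℝ => schwartzCoordMul g x * g x :=
      (schwartzCoordMul g).integrable.mul_bdd (c := SchwartzMap.seminorm ℂ 0 0 g)
        g.continuous.aestronglyMeasurable (Eventually.of_forall fun x => g.norm_le_seminorm ℂ x)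
    refine hb.norm.congr (Eventually.of_forall fun x => ?_)
    simp [schwartzCoordMul_apply]
    ring
  refine (h1.add h2).mono' (g.continuous.measurable.mul (by fun_prop)).aestronglyMeasurable
    (Eventually.of_forall fun x => ?_)
  simp only [norm_mul, Complex.norm_real, Real.norm_eq_abs, Pi.add_apply]
  nlinarith [abs_nonneg x, mul_nonneg (abs_nonneg x) (sq_nonneg (‖u x‖ - ‖g x‖)),
    mul_nonneg (abs_nonneg x) (sq_nonneg (‖u x‖)), mul_nonneg (abs_nonneg x) (sq_nonneg (‖g x‖))]

theorem memLp_phase_mul {u : ℝ → ℂ} (hu : Measurable u)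
    (h : ∫⁻ x, ‖x‖ₑ * ‖u x‖ₑ ^ 2 < ∞) (s : ℝ) : MemLp (fun x => phase s x * u x) 2 := by
  have hm := measurable_phase_right s
  refine (memLp_two_iff_integrable_sq_norm (by fun_prop)).2 ?_
  have h1 : Integrable fun x : ℝ => |x| * ‖u x‖ ^ 2 := by
    refine ⟨by fun_prop, ?_⟩
    rw [hasFiniteIntegral_iff_enorm]
    refine lt_of_eq_of_lt (lintegral_congr fun x => ?_) h
    simp [enorm_mul]
  refine (h1.const_mul (4 * Real.pi * |s|)).mono' (by fun_prop) (Eventually.of_forall fun x => ?_)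
  rw [Real.norm_of_nonneg (by positivity), norm_mul, mul_pow, ← mul_assoc]
  gcongr
  have := norm_phase_le s x
  rw [abs_mul] at this
  calc ‖phase s x‖ ^ 2 = ‖phase s x‖ * ‖phase s x‖ := sq _
    _ ≤ 2 * (2 * Real.pi * (|s| * |x|)) := by
        gcongr
        exact norm_phase_le_two s x
    _ = _ := by ring

variable {f : ℝ → ℂ} {M : ℝ}

theorem locallyIntegrable_of_bounded (hf : Measurable f) (hM : ∀ x, ‖f x‖ ≤ M) :
    LocallyIntegrable f :=
  (memLp_top_of_bound hf.aestronglyMeasurable M (Eventually.of_forall hM)).locallyIntegrable le_top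

/-- If `x 𝓕f(x) = x u(x)` as distributions, with `∫ |x| |u(x)|² dx` finite, then `f` has finite energy:
apply Plancherel's identity to `f(· + h) - f`, and integrate over `h`. -/
theorem energy_eq_of_regularPart (hf : Measurable f) (hM : ∀ x, ‖f x‖ ≤ M) {u : ℝ → ℂ}
    (hu : Measurable u) (hfin : ∫⁻ x, ‖x‖ₑ * ‖u x‖ₑ ^ 2 < ∞)
    (h : ∀ g : 𝓢(ℝ, ℂ), ∫ ξ, 𝓕 (schwartzCoordMul g) ξ * f ξ = ∫ x, g x * (x * u x)) :
    energy f = phaseConst * ∫⁻ x, ‖x‖ₑ * ‖u x‖ₑ ^ 2 := by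
  rw [energy_eq_lintegral_translate hf, ← lintegral_phase_mul_sq hu]
  refine lintegral_congr fun s => ?_
  congr 1
  refine lintegral_enorm_sq_eq_of_pairing ?_ (memLp_phase_mul hu hfin s)
    (integral_fourier_mul_sub_eq hf hM hu (integrable_schwartz_mul_coord hu hfin) h · s)
  exact (locallyIntegrable_of_bounded (hf.comp (measurable_add_const s)) fun x => hM _).sub
    (locallyIntegrable_of_bounded hf hM)

/-- The Fourier transforms of `f(· + h) - f` and `f(· + k) - f` are compatible. -/
theorem phase_mul_comm_ae (hf : Measurable f) (hM : ∀ x, ‖f x‖ ≤ M) {h k : ℝ} {D E : ℝ → ℂ}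
    (hD : MemLp D 2) (hE : MemLp E 2)
    (hDp : ∀ g : 𝓢(ℝ, ℂ), ∫ ξ, 𝓕 g ξ * (f (ξ + h) - f ξ) = ∫ x, g x * D x)
    (hEp : ∀ g : 𝓢(ℝ, ℂ), ∫ ξ, 𝓕 g ξ * (f (ξ + k) - f ξ) = ∫ x, g x * E x) :
    (fun x => phase k x * D x) =ᵐ[volume] fun x => phase h x * E x := by
  have hl : ∀ {s : ℝ} {G : ℝ → ℂ}, MemLp G 2 → LocallyIntegrable fun x => phase s x * G x := by
    intro s G hG
    refine MemLp.locallyIntegrable (p := 2) ?_ (by norm_num)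
    refine hG.of_le_mul (c := 2)
      ((measurable_phase_right s).aestronglyMeasurable.mul hG.aestronglyMeasurable)
      (Eventually.of_forall fun x => ?_)
    rw [norm_mul]
    exact mul_le_mul_of_nonneg_right (norm_phase_le_two s x) (norm_nonneg _)
  -- Multiplication with `phase s` is dual to the difference operator `G ↦ G(· + s) - G`.
  have key : ∀ {s t : ℝ} {G : ℝ → ℂ}, MemLp G 2 →
      (∀ g : 𝓢(ℝ, ℂ), ∫ ξ, 𝓕 g ξ * (f (ξ + s) - f ξ) = ∫ x, g x * G x) → ∀ g : 𝓢(ℝ, ℂ),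
      ∫ x, g x * (phase t x * G x) =
        ∫ ξ, 𝓕 g ξ * ((f (ξ + t + s) - f (ξ + t)) - (f (ξ + s) - f ξ)) := by
    intro s t G hG hp g
    have hi : ∀ g : 𝓢(ℝ, ℂ), Integrable fun x => g x * G x := fun g =>
      ((g.memLp 2).integrable_mul hG)
    have hm : Measurable fun ξ => f (ξ + s) - f ξ := by fun_prop
    have hb : ∀ ξ, ‖f (ξ + s) - f ξ‖ ≤ M + M := fun ξ =>
      (norm_sub_le _ _).trans (add_le_add (hM _) (hM _))
    have e1 : ∫ x, g x * (phase t x * G x) =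
        (∫ x, schwartzModulate t g x * G x) - ∫ x, g x * G x := by
      rw [← integral_sub (hi _) (hi _)]
      refine integral_congr_ae (Eventually.of_forall fun x => ?_)
      simp only [schwartzModulate_apply, phase]
      ring
    rw [e1, ← hp, ← hp]
    have e2 := integral_fourier_mul_sub hm hb g t
    simp_rw [fourier_schwartzModulate]
    simp only [sub_zero] at e2
    exact e2.symm
  refine ae_eq_of_schwartz_pairing (hl hD) (hl hE) fun g => ?_
  simp only [smul_eq_mul]
  rw [key hD hDp, key hE hEp]
  refine integral_congr_ae (Eventually.of_forall fun ξ => ?_)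
  simp only
  rw [add_right_comm ξ k h]
  ring

/-- A bounded function of finite energy has a Fourier transform that is a function `u` away from
`0`, with `∫ |x| |u(x)|² dx` finite. -/
theorem exists_regularPart (hf : Measurable f) (hM : ∀ x, ‖f x‖ ≤ M) (he : energy f < ∞) :
    ∃ u : ℝ → ℂ, Measurable u ∧ ∫⁻ x, ‖x‖ₑ * ‖u x‖ₑ ^ 2 < ∞ ∧
      ∀ g : 𝓢(ℝ, ℂ), ∫ ξ, 𝓕 (schwartzCoordMul g) ξ * f ξ = ∫ x, g x * (x * u x) := by
  have hdm : ∀ h, Measurable fun q => f (q + h) - f q := fun h => by fun_prop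
  -- For almost every `h` the difference `f(· + h) - f` is square integrable.
  have hgood : ∀ᵐ h : ℝ, h ≠ 0 ∧ MemLp (fun q => f (q + h) - f q) 2 := by
    rw [energy_eq_lintegral_translate hf] at he
    have hm : Measurable fun h => (∫⁻ q, ‖f (q + h) - f q‖ₑ ^ 2) / ‖h‖ₑ ^ 2 := by
      refine Measurable.div ?_ (by fun_prop)
      refine Measurable.lintegral_prod_right'
        (f := fun z : ℝ × ℝ => ‖f (z.2 + z.1) - f z.2‖ₑ ^ 2) ?_
      fun_prop
    filter_upwards [ae_lt_top hm he.ne, Measure.ae_ne volume (0 : ℝ)] with h h1 h2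
    refine ⟨h2, (memLp_two_iff_integrable_sq_norm (hdm h).aestronglyMeasurable).2
      ⟨(hdm h).norm.pow_const 2 |>.aestronglyMeasurable, ?_⟩⟩
    rw [hasFiniteIntegral_iff_enorm]
    have h3 : ∫⁻ q, ‖f (q + h) - f q‖ₑ ^ 2 < ∞ := by
      by_contra hc
      rw [not_lt_top_iff] at hc
      rw [hc, ENNReal.top_div_of_ne_top (ENNReal.pow_ne_top enorm_ne_top)] at h1
      exact lt_irrefl _ h1
    simpa using h3
  -- By `phase_mul_comm_ae`, dividing the Fourier transform of a single difference by its phase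
  -- gives a function that serves all the differences.
  obtain ⟨k, hk0, hk⟩ := hgood.exists
  obtain ⟨E, hEm, hE, hEp⟩ := exists_fourier_pair hk
  set u : ℝ → ℂ := fun x => E x / phase k x with hu_def
  have hu : Measurable u := hEm.div (measurable_phase_right k)
  -- `phase h · u` is the Fourier transform of `f(· + h) - f`, for every such `h`.
  have hpair : ∀ h, MemLp (fun q => f (q + h) - f q) 2 → MemLp (fun x => phase h x * u x) 2 ∧
      ∀ g : 𝓢(ℝ, ℂ), ∫ ξ, 𝓕 g ξ * (f (ξ + h) - f ξ) = ∫ x, g x * (phase h x * u x) := by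
    intro h hh
    obtain ⟨D, -, hD, hDp⟩ := exists_fourier_pair hh
    have e : D =ᵐ[volume] fun x => phase h x * u x := by
      filter_upwards [phase_mul_comm_ae hf hM hD hE hDp hEp, phase_ne_zero_ae hk0] with x h1 h2
      rw [hu_def]
      field_simp
      rw [mul_comm, h1]
    refine ⟨(memLp_congr_ae e).1 hD, fun g => ?_⟩
    rw [hDp]
    refine integral_congr_ae ?_
    filter_upwards [e] with x hx
    rw [hx]
  have hfin : ∫⁻ x, ‖x‖ₑ * ‖u x‖ₑ ^ 2 < ∞ := by
    have e : energy f = phaseConst * ∫⁻ x, ‖x‖ₑ * ‖u x‖ₑ ^ 2 := by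
      rw [energy_eq_lintegral_translate hf, ← lintegral_phase_mul_sq hu]
      refine lintegral_congr_ae ?_
      filter_upwards [hgood] with h hh
      congr 1
      obtain ⟨h1, h2⟩ := hpair h hh.2
      exact lintegral_enorm_sq_eq_of_pairing (hh.2.locallyIntegrable (by norm_num)) h1 h2
    rw [e] at he
    exact ENNReal.lt_top_of_mul_ne_top_right he.ne phaseConst_ne_zero
  refine ⟨u, hu, hfin, fun g => integral_fourier_coordMul_eq hf hM hu g
    (integrable_schwartz_mul_coord hu hfin g) ?_⟩
  -- A set of full measure accumulates at `0`.
  have hd := Measure.dense_of_ae hgood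
  have h0 := mem_closure_iff_frequently.1 (hd 0)
  rw [frequently_nhdsWithin_iff]
  exact h0.mono fun h hh => ⟨(hpair h hh.2).2 g, hh.1⟩
end RegularPart

/-! ### Matrix entries -/

section MatrixEntries
open Filter Topology
variable {N : ℕ}

theorem ofReal_trAbsSq (A : Matrix (Fin N) (Fin N) ℂ) :
    ENNReal.ofReal (trAbsSq A) = ∑ j, ∑ i, ‖A i j‖ₑ ^ 2 := by
  rw [trAbsSq_eq, ENNReal.ofReal_sum_of_nonneg fun j _ => Finset.sum_nonneg fun i _ => sq_nonneg _]
  refine Finset.sum_congr rfl fun j _ => ?_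
  rw [ENNReal.ofReal_sum_of_nonneg fun i _ => sq_nonneg _]
  refine Finset.sum_congr rfl fun i _ => ?_
  rw [ENNReal.ofReal_pow (norm_nonneg _), ofReal_norm]

theorem trAbsSq_nonneg (A : Matrix (Fin N) (Fin N) ℂ) : 0 ≤ trAbsSq A := by
  rw [trAbsSq_eq]
  positivity

/-- A weighted integral of `tr(|F|²)` is finite if and only if this holds for the entries of `F`. -/
theorem lintegral_trAbsSq_lt_top_iff {α : Type*} [MeasurableSpace α] {μ : Measure α}
    {F : α → Matrix (Fin N) (Fin N) ℂ} {w : α → ℝ≥0∞} (hF : ∀ i j, Measurable fun x => F x i j)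
    (hw : Measurable w) :
    ∫⁻ x, w x * ENNReal.ofReal (trAbsSq (F x)) ∂μ < ∞ ↔
      ∀ i j, ∫⁻ x, w x * ‖F x i j‖ₑ ^ 2 ∂μ < ∞ := by
  have h : ∫⁻ x, w x * ENNReal.ofReal (trAbsSq (F x)) ∂μ =
      ∑ j, ∑ i, ∫⁻ x, w x * ‖F x i j‖ₑ ^ 2 ∂μ := by
    simp_rw [ofReal_trAbsSq, Finset.mul_sum]
    have hm : ∀ i j, Measurable fun x => w x * ‖F x i j‖ₑ ^ 2 := fun i j =>
      hw.mul ((hF i j).enorm.pow_const 2)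
    rw [lintegral_finsetSum _ fun j _ => Finset.measurable_sum _ fun i _ => hm i j]
    exact Finset.sum_congr rfl fun j _ => lintegral_finsetSum _ fun i _ => hm i j
  rw [h]
  simp only [ENNReal.sum_lt_top, Finset.mem_univ, true_implies]
  exact forall_comm

theorem energy_symbol_rescale (Φ : MatrixSymbol N) (i j : Fin N) :
    energy (fun s => Φ (2 * Real.pi * s) i j) = energy fun p => Φ p i j :=
  energy_comp_mul_left (fun p => Φ p i j) (by positivity)

/-- For `x = 0` both sides are zero by the conventions for division, provided that `a` vanishes. -/
theorem ofReal_div_sq (a : ℝ) {x : ℝ} (h : x = 0 → a = 0) :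
    ENNReal.ofReal (a / |x| ^ 2) = (‖x‖ₑ ^ 2)⁻¹ * ENNReal.ofReal a := by
  rcases eq_or_ne x 0 with rfl | hx
  · simp [h rfl]
  rw [ENNReal.ofReal_div_of_pos (by positivity), ENNReal.ofReal_pow (abs_nonneg _),
    ← Real.norm_eq_abs, ofReal_norm, div_eq_mul_inv, mul_comm]

/-- The double integral of the symbol is the sum of the energies of its entries, and the energy does
not change under the rescaling by `2π`. -/
theorem lintegral_symbol_lt_top_iff (Φ : MatrixSymbol N) :
    ∫⁻ z : ℝ × ℝ, ENNReal.ofReal (trAbsSq (Φ z.1 - Φ z.2) / |z.1 - z.2| ^ 2) < ∞ ↔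
      ∀ i j, energy (fun s => Φ (2 * Real.pi * s) i j) < ∞ := by
  have h : ∀ z : ℝ × ℝ, ENNReal.ofReal (trAbsSq (Φ z.1 - Φ z.2) / |z.1 - z.2| ^ 2) =
      (‖z.1 - z.2‖ₑ ^ 2)⁻¹ * ENNReal.ofReal (trAbsSq (Φ z.1 - Φ z.2)) := by
    intro z
    refine ofReal_div_sq _ fun h0 => ?_
    rw [sub_eq_zero.1 h0, sub_self, trAbsSq_eq]
    simp
  have hm : ∀ i j, Measurable fun z : ℝ × ℝ => (Φ z.1 - Φ z.2) i j := fun i j =>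
    ((measurable_symbol Φ i j).comp measurable_fst).sub
      ((measurable_symbol Φ i j).comp measurable_snd)
  simp_rw [h]
  rw [lintegral_trAbsSq_lt_top_iff hm (by fun_prop)]
  refine forall₂_congr fun i j => ?_
  rw [energy_symbol_rescale, energy, Measure.volume_eq_prod, lintegral_prod_symm]
  · simp_rw [div_eq_mul_inv, mul_comm (_⁻¹ : ℝ≥0∞)]
    rfl
  · exact (Measurable.mul (by fun_prop) ((hm i j).enorm.pow_const 2)).aemeasurable

theorem integral_matrix_apply {α : Type*} [MeasurableSpace α] {μ : Measure α}
    {F : α → Matrix (Fin N) (Fin N) ℂ} (hF : Integrable F μ) (i j : Fin N) :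
    (∫ x, F x ∂μ) i j = ∫ x, F x i j ∂μ :=
  ((entryCLM i j).integral_comp_comm hF).symm

theorem lintegral_coord_const_mul_lt_top {c : ℂ} {u : ℝ → ℂ}
    (h : ∫⁻ x : ℝ, ‖x‖ₑ * ‖u x‖ₑ ^ 2 < ∞) : ∫⁻ x : ℝ, ‖x‖ₑ * ‖c * u x‖ₑ ^ 2 < ∞ := by
  have e : ∀ x : ℝ, ‖x‖ₑ * ‖c * u x‖ₑ ^ 2 = ‖c‖ₑ ^ 2 * (‖x‖ₑ * ‖u x‖ₑ ^ 2) := fun x => by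
    rw [enorm_mul, mul_pow, mul_left_comm]
  simp_rw [e]
  rw [lintegral_const_mul' _ _ (ENNReal.pow_ne_top enorm_ne_top)]
  exact ENNReal.mul_lt_top (ENNReal.pow_lt_top enorm_lt_top) h

theorem schwartzHat_two_pi_mul (g : 𝓢(ℝ, ℂ)) (ξ : ℝ) :
    schwartzHat g (2 * Real.pi * ξ) = 𝓕 g ξ := by
  have h : schwartzHat g (2 * Real.pi * ξ) = 𝓕 g ((2 * Real.pi)⁻¹ * (2 * Real.pi * ξ)) := rfl
  rw [h, inv_mul_cancel_left₀ (by positivity)]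

/-- The entries of the distribution `x Φ^`, written in terms of the rescaled symbol. -/
theorem coordMul_distHat_apply (Φ : MatrixSymbol N) (g : 𝓢(ℝ, ℂ)) (i j : Fin N) :
    coordMul (distHat (Lp.toTemperedDistribution Φ)) g i j =
      2 * Real.pi * ∫ ξ, 𝓕 (schwartzCoordMul g) ξ * Φ (2 * Real.pi * ξ) i j := by
  rw [coordMul_apply _ g (schwartzCoordMul g) (schwartzCoordMul_apply g), distHat_apply,
    Lp.toTemperedDistribution_apply]
  have hi : Integrable fun p => schwartzHat (schwartzCoordMul g) p • Φ p := by
    have := (Lp.memLp Φ).smul (p := 1) (q := ∞) (r := 1)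
      ((schwartzHat (schwartzCoordMul g)).memLp 1)
    exact memLp_one_iff_integrable.1 this
  rw [integral_matrix_apply hi]
  have h := Measure.integral_comp_mul_left
    (fun p => schwartzHat (schwartzCoordMul g) p * Φ p i j) (2 * Real.pi)
  simp_rw [schwartzHat_two_pi_mul] at h
  rw [h, abs_of_pos (by positivity), Complex.real_smul, ← mul_assoc]
  have : (2 * Real.pi * ((2 * Real.pi)⁻¹ : ℝ) : ℂ) = 1 := by
    rw [← Complex.ofReal_ofNat, ← Complex.ofReal_mul, ← Complex.ofReal_mul,
      mul_inv_cancel₀ (by positivity), Complex.ofReal_one]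
  rw [this, one_mul]
  rfl

theorem integrable_of_entries {α : Type*} [MeasurableSpace α] {μ : Measure α}
    {F : α → Matrix (Fin N) (Fin N) ℂ} (h : ∀ i j, Integrable (fun x => F x i j) μ) :
    Integrable F μ := by
  have e : F = fun x => ∑ i, ∑ j, F x i j • Matrix.single i j (1 : ℂ) := by
    funext x
    conv_lhs => rw [Matrix.matrix_eq_sum_single (F x)]
    simp
  rw [e]
  exact integrable_finsetSum _ fun i _ => integrable_finsetSum _ fun j _ =>
    (h i j).smul_const _

theorem lintegral_regularPart_lt_top_iff {Ψ : ℝ → Matrix (Fin N) (Fin N) ℂ}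
    (hm : ∀ i j, Measurable fun x => Ψ x i j) :
    ∫⁻ x : ℝ, ENNReal.ofReal (|x| * trAbsSq (Ψ x)) < ∞ ↔
      ∀ i j, ∫⁻ x : ℝ, ‖x‖ₑ * ‖Ψ x i j‖ₑ ^ 2 < ∞ := by
  rw [← lintegral_trAbsSq_lt_top_iff hm (by fun_prop)]
  simp_rw [ENNReal.ofReal_mul (abs_nonneg _), ← Real.norm_eq_abs, ofReal_norm]

/-- A symbol has a regular part if and only if its entries have finite energy. The factor `2π` in the
regular part comes from the rescaling of the symbol. -/
theorem exists_isRegularPart_iff (Φ : MatrixSymbol N) :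
    (∃ Ψ : ℝ → Matrix (Fin N) (Fin N) ℂ, IsRegularPart Φ Ψ) ↔
      ∀ i j, energy (fun s => Φ (2 * Real.pi * s) i j) < ∞ := by
  have hpi : (2 * Real.pi : ℂ) ≠ 0 := by simp [Real.pi_ne_zero]
  have hpair : ∀ {i j : Fin N} {b : ℝ → ℂ}, (fun s => Φ (2 * Real.pi * s) i j) =ᵐ[volume] b →
      ∀ g : 𝓢(ℝ, ℂ), ∫ ξ, 𝓕 g ξ * Φ (2 * Real.pi * ξ) i j = ∫ ξ, 𝓕 g ξ * b ξ := by
    intro i j b hb g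
    refine integral_congr_ae ?_
    filter_upwards [hb] with ξ h
    rw [h]
  constructor
  · rintro ⟨Ψ, hΨ⟩ i j
    have hfin := (lintegral_regularPart_lt_top_iff hΨ.measurable).1 hΨ.finite
    have hint := fun i j => integrable_schwartz_mul_coord (hΨ.measurable i j) (hfin i j)
    obtain ⟨b, M, hb, hM, hfb⟩ := exists_bounded_representative (measurable_symbol_rescale Φ i j)
      (memLp_symbol_rescale Φ i j)
    have hu : Measurable fun x => (2 * Real.pi : ℂ)⁻¹ * Ψ x i j := (hΨ.measurable i j).const_mul _
    have hu2 : ∫⁻ x, ‖x‖ₑ * ‖(2 * Real.pi : ℂ)⁻¹ * Ψ x i j‖ₑ ^ 2 < ∞ :=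
      lintegral_coord_const_mul_lt_top (hfin i j)
    rw [energy_congr hfb, energy_eq_of_regularPart hb hM hu hu2 fun g => ?_]
    · exact ENNReal.mul_lt_top phaseConst_lt_top hu2
    · have h := coordMul_distHat_apply Φ g i j
      have hi : Integrable fun x : ℝ => g x • (x : ℂ) • Ψ x :=
        integrable_of_entries fun i j => hint i j g
      rw [hΨ.eq_dist, integral_matrix_apply hi, hpair hfb] at h
      rw [← mul_right_inj' hpi, ← h, ← integral_const_mul]
      refine integral_congr_ae (Eventually.of_forall fun x => ?_)
      simp only [Matrix.smul_apply, smul_eq_mul]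
      field_simp
  · intro h
    have hex : ∀ i j, ∃ u : ℝ → ℂ, Measurable u ∧ ∫⁻ x, ‖x‖ₑ * ‖u x‖ₑ ^ 2 < ∞ ∧
        ∀ g : 𝓢(ℝ, ℂ), ∫ ξ, 𝓕 (schwartzCoordMul g) ξ * Φ (2 * Real.pi * ξ) i j =
          ∫ x, g x * (x * u x) := by
      intro i j
      obtain ⟨b, M, hb, hM, hfb⟩ := exists_bounded_representative (measurable_symbol_rescale Φ i j)
        (memLp_symbol_rescale Φ i j)
      obtain ⟨u, h1, h2, h3⟩ := exists_regularPart hb hM (by rw [← energy_congr hfb]; exact h i j)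
      exact ⟨u, h1, h2, fun g => (hpair hfb _).trans (h3 g)⟩
    choose u hu hfin hp using hex
    have hm : ∀ i j, Measurable fun x => (2 * Real.pi : ℂ) * u i j x := fun i j =>
      (hu i j).const_mul _
    have hfin' : ∀ i j, ∫⁻ x, ‖x‖ₑ * ‖(2 * Real.pi : ℂ) * u i j x‖ₑ ^ 2 < ∞ := fun i j =>
      lintegral_coord_const_mul_lt_top (hfin i j)
    refine ⟨fun x => Matrix.of fun i j => 2 * Real.pi * u i j x, hm,
      (lintegral_regularPart_lt_top_iff hm).2 hfin', fun g => ?_⟩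
    ext i j
    have hi : Integrable fun x : ℝ => g x • (x : ℂ) •
        (Matrix.of fun i j => (2 * Real.pi : ℂ) * u i j x : Matrix (Fin N) (Fin N) ℂ) :=
      integrable_of_entries fun i j => integrable_schwartz_mul_coord (hm i j) (hfin' i j) g
    rw [coordMul_distHat_apply, hp, ← integral_const_mul, integral_matrix_apply hi]
    refine integral_congr_ae (Eventually.of_forall fun x => ?_)
    simp only [Matrix.smul_apply, smul_eq_mul, Matrix.of_apply]
    ring

/-- A projection is admissible if and only if its entries have finite energy. -/
theorem isAdmissible_iff {Φ : MatrixSymbol N} (hΦ : IsProjectionSymbol Φ) :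
    IsAdmissible Φ ↔ ∀ i j, energy (fun s => Φ (2 * Real.pi * s) i j) < ∞ :=
  ⟨fun h => energy_lt_top_of_isHilbertSchmidt Φ (hΦ.mono fun _ h => h.isSelfAdjoint) h.2,
    fun h => ⟨hΦ, isHilbertSchmidt_hankel_of_energy Φ h⟩⟩

theorem lintegral_dilation_lt_top {Φ : MatrixSymbol N}
    (h : ∀ i j, energy (fun s => Φ (2 * Real.pi * s) i j) < ∞) :
    ∫⁻ p : ℝ, ENNReal.ofReal (trAbsSq (Φ (2 * p) - Φ p) / |p|) < ∞ := by
  have hm : ∀ i j, Measurable fun p => (Φ (2 * p) - Φ p) i j := fun i j =>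
    ((measurable_symbol Φ i j).comp (measurable_const_mul 2)).sub (measurable_symbol Φ i j)
  have e : ∀ p : ℝ, ENNReal.ofReal (trAbsSq (Φ (2 * p) - Φ p) / |p|) =
      ‖p‖ₑ⁻¹ * ENNReal.ofReal (trAbsSq (Φ (2 * p) - Φ p)) := by
    intro p
    rcases eq_or_ne p 0 with rfl | hp
    · simp [trAbsSq_eq]
    rw [ENNReal.ofReal_div_of_pos (by positivity), ← Real.norm_eq_abs, ofReal_norm,
      div_eq_mul_inv, mul_comm]
  simp_rw [e]
  refine (lintegral_trAbsSq_lt_top_iff hm (by fun_prop)).2 fun i j => ?_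
  have h1 := lintegral_dilation_two_le (measurable_symbol Φ i j)
  rw [← energy_symbol_rescale] at h1
  refine lt_of_le_of_lt (le_trans (le_of_eq (lintegral_congr fun p => ?_)) h1)
    (ENNReal.mul_lt_top (by simp) (h i j))
  rw [div_eq_mul_inv, mul_comm]
  rfl

theorem energy_lt_top_of_even_matrix {Φ : MatrixSymbol N} {F : ℝ → Matrix (Fin N) (Fin N) ℂ}
    (hΦ : Φ =ᵐ[volume] F) (he : Function.Even F) (hd : Differentiable ℝ F)
    (h : ∫⁻ p in Set.Ioi (0 : ℝ), ENNReal.ofReal (trAbsSq (deriv F p) * p) < ∞) (i j : Fin N) :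
    energy (fun s => Φ (2 * Real.pi * s) i j) < ∞ := by
  have hde : ∀ i j p, HasDerivAt (fun p => F p i j) (deriv F p i j) p := fun i j p =>
    ((entryCLM i j).restrictScalars ℝ).hasFDerivAt.comp_hasDerivAt p (hd p).hasDerivAt
  have hderiv : ∀ i j, deriv (fun p => F p i j) = fun p => deriv F p i j := fun i j =>
    funext fun p => (hde i j p).deriv
  have hm : ∀ i j, Measurable fun p => deriv F p i j := fun i j => by
    rw [← hderiv]
    exact measurable_deriv _
  have hw : ∫⁻ p in Set.Ioi (0 : ℝ),
      ENNReal.ofReal p * ENNReal.ofReal (trAbsSq (deriv F p)) < ∞ := by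
    refine lt_of_eq_of_lt (lintegral_congr fun p => ?_) h
    rw [ENNReal.ofReal_mul (trAbsSq_nonneg _), mul_comm]
  have h1 := (lintegral_trAbsSq_lt_top_iff hm (by fun_prop)).1 hw i j
  rw [energy_symbol_rescale,
    energy_congr (g := fun p => F p i j) (hΦ.mono fun p hp => by simp [hp])]
  refine energy_lt_top_of_even (fun p => (hde i j p).differentiableAt)
    (fun p => by simp only [he p]) ?_
  rw [hderiv]
  refine lt_of_eq_of_lt ?_ h1
  rw [← lintegral_indicator measurableSet_Ioi]
  refine lintegral_congr fun p => ?_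
  by_cases hp : 0 < p
  · rw [Set.indicator_of_mem (by exact hp), mul_comm]
  · rw [Set.indicator_of_notMem (by exact hp), ENNReal.ofReal_of_nonpos (not_lt.1 hp), mul_zero]

end MatrixEntries

end CARFlow

end

theorem mainTheorem6 (N : ℕ) (Φ : CARFlow.MatrixSymbol N) (hΦ : CARFlow.IsProjectionSymbol Φ) :
    List.TFAE
      [CARFlow.IsAdmissible Φ,
        ∫⁻ z : ℝ × ℝ, ENNReal.ofReal
          (CARFlow.trAbsSq (Φ z.1 - Φ z.2) / |z.1 - z.2| ^ 2) < ∞,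
        ∃ Ψ : ℝ → Matrix (Fin N) (Fin N) ℂ, CARFlow.IsRegularPart Φ Ψ] ∧
    (CARFlow.IsAdmissible Φ →
      ∫⁻ p : ℝ, ENNReal.ofReal (CARFlow.trAbsSq (Φ (2 * p) - Φ p) / |p|) < ∞) ∧
    (∀ F : ℝ → Matrix (Fin N) (Fin N) ℂ, Φ =ᵐ[volume] F → Function.Even F → Differentiable ℝ F →
      ∫⁻ p in Set.Ioi (0 : ℝ), ENNReal.ofReal (CARFlow.trAbsSq (deriv F p) * p) < ∞ →
      CARFlow.IsAdmissible Φ) := by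
  refine ⟨?_, fun h => ?_, fun F hF he hd h => ?_⟩
  · rw [CARFlow.isAdmissible_iff hΦ, CARFlow.lintegral_symbol_lt_top_iff,
      CARFlow.exists_isRegularPart_iff]
    tfae_finish
  · exact CARFlow.lintegral_dilation_lt_top ((CARFlow.isAdmissible_iff hΦ).1 h)
  · exact (CARFlow.isAdmissible_iff hΦ).2 (CARFlow.energy_lt_top_of_even_matrix hF he hd h)
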